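/- \textbf{Setting.} Let $p\ge 1$ be an integer, let $(\mathcal X,\lambda)$ be a probability space (for instance a measurable subset of $\mathbb R^{d}$ with a probability measure), and put $L^2_\lambda=L^2(\mathcal X,\mathbb R^p,d\lambda)$. Let $\mathcal V$ be a real Hilbert space, $\Theta\subset\mathcal V$, $\mathscr G:\Theta\to L^2_\lambda$ a map, and $q_\varepsilon$ a probability density on $\mathbb R^p$ such that $\sqrt{q_\varepsilon}$ belongs to the Sobolev space $H^1(\mathbb R^p)$; let $\nabla\sqrt{q_\varepsilon}$ be any version of its weak gradient. For $\theta\in\Theta$ let $P_\theta$ be the law of $(X,Y)$, where $Y=\mathscr G(\theta)(X)+\varepsilon$ with $X\sim\lambda$ and $\varepsilon\sim q_\varepsilon$ independent, and let $P_\theta^N$ be its $N$-fold product, the law of $(X_i,Y_i)_{i=1}^N$. Fix $\theta_0\in\Theta$ and a linear subspace $\mathcal V_0\subset\mathcal V$ such that for every $h\in\mathcal V_0$ there is $\delta(h)>0$ with $\theta_0+sh\in\Theta$ for $|s|<\delta(h)$, and let $\mathbb I_{\theta_0}:(\mathcal V_0,\|\cdot\|_{\mathcal V})\to L^2_\lambda$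 be linear and continuous with $$\|\mathscr G(\theta_0+sh)-\mathscr G(\theta_0)-\mathbb I_{\theta_0}[sh]\|_{L^2_\lambda}=o(|s|)\quad (s\to0)\qquad\text{for each fixed } h\in\mathcal V_0.$$ A continuous linear operator on $\mathcal V_0$ with values in a Hilbert space and its unique continuous extension to the closure $\overline{\mathcal V}_0$ of $\mathcal V_0$ in $\mathcal V$ are denoted by the same symbol; adjoints are taken between $\overline{\mathcal V}_0$ and the target Hilbert space. \textbf{Conclusion.} $P_\theta$ has density $p_\theta(x,y)=q_\varepsilon(y-\mathscr G(\theta)(x))$ with respect to $d\lambda\otimes dy$ for every $\theta\in\Theta$, and the following hold. (i) The model $(P_\theta)$ is differentiable in quadratic mean at $\theta_0$: there is a linear and continuous score operator $\mathbb A_{\theta_0}:(\mathcal V_0,\|\cdot\|_{\mathcal V})\to L^2(\mathcal X\times\mathbb R^p,P_{\theta_0})$, given $P_{\theta_0}$-almost everywhere by $$\mathbb A_{\theta_0}[h](x,y)=-2\,\frac{\big\langle(\nabla\sqrt{q_\varepsilon})(y-\mathscr G(\theta_0)(x)),\,\mathbb I_{\theta_0}[h](x)\big\rangle_{\mathbb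 R^p}}{\sqrt{p_{\theta_0}(x,y)}}\,\mathbf 1[p_{\theta_0}(x,y)>0],$$ such that for every $h\in\mathcal V_0$ $$\lim_{s\to0}\frac1{s^2}\int_{\mathcal X\times\mathbb R^p}\Big(\sqrt{p_{\theta_0+sh}}-\sqrt{p_{\theta_0}}-\frac s2\,\mathbb A_{\theta_0}[h]\sqrt{p_{\theta_0}}\Big)^2d\lambda(x)\,dy=0 .$$ The information operator satisfies, on $\overline{\mathcal V}_0$, $$\mathbb A_{\theta_0}^*\mathbb A_{\theta_0}=\mathbb I_{\theta_0}^*\,\mathcal I_\varepsilon\,\mathbb I_{\theta_0},$$ where the matrix $$\mathcal I_\varepsilon=4\int_{\mathbb R^p}(\nabla\sqrt{q_\varepsilon})(\nabla\sqrt{q_\varepsilon})^T\,dy=4\,\mathbb E_{\varepsilon\sim q_\varepsilon}\bigg[\frac{\nabla\sqrt{q_\varepsilon}}{\sqrt{q_\varepsilon}}(\varepsilon)\,\frac{(\nabla\sqrt{q_\varepsilon})^T}{\sqrt{q_\varepsilon}}(\varepsilon)\bigg]$$ (both integrals being absolutely convergent) acts pointwise on $L^2_\lambda$. (ii) The Fisher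 information matrix $\mathcal I_\varepsilon$ is symmetric positive definite, hence invertible. (iii) The model $\{P_\theta^N\}$ is locally asymptotically normal at $\theta_0$ with respect to $\mathcal V_0$, with LAN norm $\|h\|_{\rm LAN}=\|\mathcal I_\varepsilon^{1/2}\,\mathbb I_{\theta_0}[h]\|_{L^2_\lambda}$: for every fixed $h\in\mathcal V_0$, as $N\to\infty$ and under $P_{\theta_0}^N$ with $\varepsilon_i=Y_i-\mathscr G(\theta_0)(X_i)$, the likelihood ratio $dP^N_{\theta_0+h/\sqrt N}/dP^N_{\theta_0}$ (the density of the absolutely continuous part) is positive with probability tending to $1$, and $$\log\frac{dP^N_{\theta_0+h/\sqrt N}}{dP^N_{\theta_0}}\big((X_i,Y_i)_{i=1}^N\big)=-\frac{2}{\sqrt N}\sum_{i=1}^N\Big\langle\mathbb I_{\theta_0}[h](X_i),\frac{\nabla\sqrt{q_\varepsilon}}{\sqrt{q_\varepsilon}}(\varepsilon_i)\Big\rangle_{\mathbb R^p}-\frac12\|h\|_{\rm LAN}^2+o_{P^N_{\theta_0}}(1)\ \xrightarrow{\ d\ }\ \mathcal N\Big(-\frac12\|h\|^2_{\rm LAN},\|h\|^2_{\rm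 LAN}\Big).$$ -/

import Mathlib

open MeasureTheory ProbabilityTheory Filter Topology

namespace RegressionLAN

noncomputable section

/-- `g` is a version of the weak gradient of `f` on `ℝ^p`:
`∫ f ∂_v φ = - ∫ ⟨g, v⟩ φ` for all `φ ∈ C_c^∞(ℝ^p)` and all directions `v`. -/
def HasWeakGradient {p : ℕ} (f : EuclideanSpace ℝ (Fin p) → ℝ)
    (g : EuclideanSpace ℝ (Fin p) → EuclideanSpace ℝ (Fin p)) : Prop :=
  LocallyIntegrable f volume ∧ LocallyIntegrable g volume ∧
    ∀ φ : EuclideanSpace ℝ (Fin p) → ℝ, ContDiff ℝ (⊤ : ℕ∞) φ → HasCompactSupport φ →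
      ∀ v : EuclideanSpace ℝ (Fin p),
        ∫ y, f y * fderiv ℝ φ y v = - ∫ y, inner ℝ (g y) v * φ y

/-- The Sobolev space `H¹(ℝ^p)`: square integrable with square integrable weak gradient. -/
def MemH1 {p : ℕ} (f : EuclideanSpace ℝ (Fin p) → ℝ) : Prop :=
  MemLp f 2 volume ∧ ∃ g, MemLp g 2 volume ∧ HasWeakGradient f g

/-- The law on `ℝ^p` with Lebesgue density `q`. -/
def errorLaw {p : ℕ} (q : EuclideanSpace ℝ (Fin p) → ℝ) :
    Measure (EuclideanSpace ℝ (Fin p)) :=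
  volume.withDensity fun y => ENNReal.ofReal (q y)

/-- The joint law of `(X, Y)` where `Y = g(X) + ε`, with `X ∼ ν` and `ε ∼ q` independent. -/
def regLaw {X : Type*} [MeasurableSpace X] {p : ℕ} (ν : Measure X)
    (q : EuclideanSpace ℝ (Fin p) → ℝ) (g : X → EuclideanSpace ℝ (Fin p)) :
    Measure (X × EuclideanSpace ℝ (Fin p)) :=
  (ν.prod (errorLaw q)).map fun z => (z.1, g z.1 + z.2)

/-- The density `(x, y) ↦ q (y - g(x))`. -/
def regDensity {X : Type*} {p : ℕ} (q : EuclideanSpace ℝ (Fin p) → ℝ)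
    (g : X → EuclideanSpace ℝ (Fin p)) (z : X × EuclideanSpace ℝ (Fin p)) : ℝ :=
  q (z.2 - g z.1)

/-- `G` is differentiable at `θ₀ ∈ Θ` in every fixed direction of the linear subspace `V₀`, with
continuous linearization `I : V₀ → F`. Only the values of `G` on `Θ` are relevant. -/
structure IsLinearization {V F : Type*} [NormedAddCommGroup V] [NormedSpace ℝ V]
    [NormedAddCommGroup F] [NormedSpace ℝ F] (Θ : Set V) (G : V → F) (θ₀ : V)
    (V₀ : Submodule ℝ V) (I : V₀ →L[ℝ] F) : Prop where
  mem : θ₀ ∈ Θ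
  segment_mem : ∀ h ∈ V₀, ∃ δ > 0, ∀ s : ℝ, |s| < δ → θ₀ + s • h ∈ Θ
  isLittleO : ∀ h : V₀,
    (fun s : ℝ => G (θ₀ + s • (h : V)) - G θ₀ - I (s • h)) =o[𝓝 0] fun s : ℝ => s

/-- Differentiability in quadratic mean at `θ₀` along `V₀`, with score operator `A`, of a model
with densities `p θ` with respect to `μ`. -/
def IsQMD {V Ω : Type*} [NormedAddCommGroup V] [NormedSpace ℝ V] [MeasurableSpace Ω]
    (μ : Measure Ω) (p : V → Ω → ℝ) (θ₀ : V) (V₀ : Submodule ℝ V) (A : V₀ → Ω → ℝ) : Prop :=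
  ∀ h : V₀, Tendsto
    (fun s : ℝ => ENNReal.ofReal (1 / s ^ 2) *
      ∫⁻ z, ENNReal.ofReal
        ((√(p (θ₀ + s • (h : V)) z) - √(p θ₀ z) - s / 2 * A h z * √(p θ₀ z)) ^ 2) ∂μ)
    (𝓝[≠] 0) (𝓝 0)

/-- The inclusion of `V₀` in its closure. -/
def toClosure {V : Type*} [NormedAddCommGroup V] [NormedSpace ℝ V] (V₀ : Submodule ℝ V) :
    V₀ →L[ℝ] V₀.topologicalClosure :=
  V₀.subtypeL.codRestrict V₀.topologicalClosure fun h => V₀.le_topologicalClosure h.2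

/-- The continuous extension of `T` from `V₀` to its closure. -/
def extendToClosure {V F : Type*} [NormedAddCommGroup V] [NormedSpace ℝ V]
    [NormedAddCommGroup F] [NormedSpace ℝ F] [CompleteSpace F] {V₀ : Submodule ℝ V}
    (T : V₀ →L[ℝ] F) : V₀.topologicalClosure →L[ℝ] F :=
  T.extend (toClosure V₀)

theorem extendToClosure_apply {V F : Type*} [NormedAddCommGroup V] [NormedSpace ℝ V]
    [NormedAddCommGroup F] [NormedSpace ℝ F] [CompleteSpace F] {V₀ : Submodule ℝ V}
    (T : V₀ →L[ℝ] F) (h : V₀) : extendToClosure T (toClosure V₀ h) = T h := by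
  have hiso : Isometry (toClosure V₀) := fun _ _ => rfl
  refine ContinuousLinearMap.extend_eq T ?_ hiso.isUniformInducing h
  exact (denseRange_inclusion_iff (t := (V₀.topologicalClosure : Set V))
    V₀.le_topologicalClosure).2 fun _ hx => hx

/-- The Fisher information matrix `4 ∫ g gᵀ dy`, where `g = ∇√q`. -/
def fisherMatrix {p : ℕ} (g : EuclideanSpace ℝ (Fin p) → EuclideanSpace ℝ (Fin p)) :
    Matrix (Fin p) (Fin p) ℝ :=
  Matrix.of fun i j => 4 * ∫ y, g y i * g y j

open scoped MatrixOrder in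
/-- The nonnegative square root of a positive semidefinite matrix. -/
def matrixSqrt {p : ℕ} (M : Matrix (Fin p) (Fin p) ℝ) : Matrix (Fin p) (Fin p) ℝ :=
  CFC.sqrt M

/-- Pointwise action of a matrix on `L²(ν; ℝ^p)`. -/
def matrixAct {X : Type*} [MeasurableSpace X] {p : ℕ} (ν : Measure X)
    (M : Matrix (Fin p) (Fin p) ℝ) :
    Lp (EuclideanSpace ℝ (Fin p)) 2 ν →L[ℝ] Lp (EuclideanSpace ℝ (Fin p)) 2 ν :=
  (Matrix.toEuclideanCLM (n := Fin p) (𝕜 := ℝ) M).compLpL 2 ν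

/-- The norm `‖M^{1/2} I[h]‖` of `L²(ν; ℝ^p)`. -/
def lanNorm {X V : Type*} [MeasurableSpace X] [NormedAddCommGroup V] [NormedSpace ℝ V] {p : ℕ}
    {ν : Measure X} {V₀ : Submodule ℝ V} (M : Matrix (Fin p) (Fin p) ℝ)
    (I : V₀ →L[ℝ] Lp (EuclideanSpace ℝ (Fin p)) 2 ν) (h : V₀) : ℝ :=
  ‖matrixAct ν (matrixSqrt M) (I h)‖

/-- The score function
`(x, y) ↦ -2 ⟨g(y - G(x)), u(x)⟩ / √q(y - G(x)) · 1[q(y - G(x)) > 0]`, where `g = ∇√q`. -/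
def scoreFun {X : Type*} {p : ℕ} (q : EuclideanSpace ℝ (Fin p) → ℝ)
    (g : EuclideanSpace ℝ (Fin p) → EuclideanSpace ℝ (Fin p))
    (G u : X → EuclideanSpace ℝ (Fin p)) (z : X × EuclideanSpace ℝ (Fin p)) : ℝ :=
  Set.indicator {z | 0 < regDensity q G z}
    (fun z => -2 * inner ℝ (g (z.2 - G z.1)) (u z.1) / √(regDensity q G z)) z

/-- The law of `N` independent observations from `P`. -/
def sampleLaw {Ω : Type*} [MeasurableSpace Ω] (P : Measure Ω) (N : ℕ) : Measure (Fin N → Ω) :=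
  Measure.pi fun _ => P

/-- The likelihood ratio `dQ^N/dP^N`: the density with respect to `P^N` of the part of `Q^N` that
is absolutely continuous with respect to `P^N`. -/
def likelihoodRatio {Ω : Type*} [MeasurableSpace Ω] (Q P : Measure Ω) (N : ℕ) :
    (Fin N → Ω) → ENNReal :=
  (sampleLaw Q N).rnDeriv (sampleLaw P N)

/-- The real logarithm of the likelihood ratio, set to `0` where the ratio is `0` or `∞`. -/
def logLR {Ω : Type*} [MeasurableSpace Ω] (Q P : Measure Ω) (N : ℕ) (ω : Fin N → Ω) : ℝ :=
  Real.log (likelihoodRatio Q P N ω).toReal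

/-- Local asymptotic normality at `θ₀` along `V₀`, with central variables `Δ N h` and LAN norm
`nrm`. The first clause says that, with probability tending to `1`, the likelihood ratio is
positive and its logarithm finite, the second is the expansion up to `o_P(1)`, and the third the
convergence in distribution to `N(-‖h‖²/2, ‖h‖²)`, all under `P_{θ₀}^N`. -/
def IsLAN {V Ω : Type*} [NormedAddCommGroup V] [NormedSpace ℝ V] [MeasurableSpace Ω]
    (P : V → Measure Ω) (θ₀ : V) (V₀ : Submodule ℝ V)
    (Δ : (N : ℕ) → V₀ → (Fin N → Ω) → ℝ) (nrm : V₀ → ℝ) : Prop :=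
  ∀ h : V₀,
    let θ : ℕ → V := fun N => θ₀ + (1 / √(N : ℝ)) • (h : V)
    Tendsto (fun N : ℕ => sampleLaw (P θ₀) N
        {ω | likelihoodRatio (P (θ N)) (P θ₀) N ω = 0}) atTop (𝓝 0) ∧
    (∀ δ > 0, Tendsto (fun N : ℕ => sampleLaw (P θ₀) N
        {ω | δ ≤ |logLR (P (θ N)) (P θ₀) N ω - (Δ N h ω - 1 / 2 * nrm h ^ 2)|})
      atTop (𝓝 0)) ∧
    (∀ f : BoundedContinuousFunction ℝ ℝ, Tendsto
      (fun N : ℕ => ∫ ω, f (logLR (P (θ N)) (P θ₀) N ω) ∂(sampleLaw (P θ₀) N)) atTop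
      (𝓝 (∫ t, f t ∂(gaussianReal (-(1 / 2) * nrm h ^ 2) (nrm h ^ 2).toNNReal))))

end

end RegressionLAN

open RegressionLAN

/-!
Write `f = √q` and `g = ∇f`.

The analytic core is that a Sobolev function is differentiable in `L²` under translation:
`‖f(· + sv) - f - s⟨g, v⟩‖ = o(s)`, together with `‖f(· + v) - f‖ ≤ ‖⟨g, v⟩‖`
(`HasWeakGradient.tendsto_eLpNorm_slope_sub`, `HasWeakGradient.eLpNorm_translate_sub_le_inner`).
Both follow from one Taylor estimate, `HasWeakGradient.eLpNorm_translate_sub_le`: tested against a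
smooth `φ` with compact support, the translate `t ↦ ∫ f(y + tv) φ(y) dy` is a differentiable function
of one variable whose derivative involves only `g`, so that the mean value inequality and duality
apply. Differentiability in `L²` also shows that `g` vanishes almost everywhere where `q` does
(`HasWeakGradient.ae_eq_zero_of_eq_zero`), which makes the indicator in the score harmless. The
Lipschitz bound shows that a vector `v ≠ 0` in the kernel of the Fisher matrix would make the
probability measure `q dy` invariant under translation by `v`, which is impossible
(`posDef_fisherMatrix`).

Quadratic mean differentiability of the model (`HasWeakGradient.tendsto_lintegral_regression`) is
checked in residual coordinates. There the linearization error of the regression map enters only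
through the Lipschitz bound, and the linear part is handled by dominated convergence over the
covariate. The score is bounded on `L²(ν; ℝ^p)`, and Fubini's theorem identifies its Gram operator
with the pointwise action of the Fisher matrix (`exists_scoreOperator`); this gives the formula for
the information operator after extension to the closure.

Local asymptotic normality (`lan_of_qmd`) holds for every dominated model that is differentiable in
quadratic mean. With `T = √(p₁/p₀) - 1`, the log-likelihood ratio is `∑ 2 log(1 + Tᵢ)`, which is
expanded as `2 ∑ Tᵢ - ∑ Tᵢ²` since the `Tᵢ` are uniformly small (`tendstoInMeasure_sum_log`). By
quadratic mean differentiability `2 ∑ Tᵢ` is `N^{-1/2} ∑ a(ωᵢ)` up to a deterministic drift, where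
`a` is the score. Square roots of densities are unit vectors of `L²`, and this forces the drift to be
`-‖a‖²/4` and the score to be centered (`tendsto_mul_inner_of_norm_eq_one`). The law of large numbers
gives `∑ Tᵢ² → ‖a‖²/4`, and the central limit theorem the limit in distribution. All sample sizes
live on one infinite product space, and the likelihood ratio of the product measures is identified
in `likelihoodRatio_ae_eq`.
-/

namespace RegressionLAN

open scoped ENNReal

/-! ### Square integrable functions -/

section L2

variable {Ω : Type*} [MeasurableSpace Ω] {μ : Measure Ω}

theorem inner_toLp_eq_integral {w φ : Ω → ℝ} (hw : MemLp w 2 μ) (hφ : MemLp φ 2 μ) :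
    inner ℝ (hw.toLp w) (hφ.toLp φ) = ∫ z, w z * φ z ∂μ := by
  rw [L2.inner_def]
  refine integral_congr_ae ?_
  filter_upwards [hw.coeFn_toLp, hφ.coeFn_toLp] with z h1 h2
  simp [h1, h2, mul_comm]

theorem abs_integral_mul_le {w φ : Ω → ℝ} (hw : MemLp w 2 μ) (hφ : MemLp φ 2 μ) :
    |∫ z, w z * φ z ∂μ| ≤ (eLpNorm w 2 μ).toReal * (eLpNorm φ 2 μ).toReal := by
  rw [← inner_toLp_eq_integral hw hφ, ← Lp.norm_toLp w hw, ← Lp.norm_toLp φ hφ]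
  exact abs_real_inner_le_norm _ _

theorem eLpNorm_two_sq_enorm {F : Type*} [NormedAddCommGroup F] (w : Ω → F) :
    eLpNorm w 2 μ ^ 2 = ∫⁻ z, ‖w z‖ₑ ^ 2 ∂μ := by
  have h := eLpNorm_nnreal_pow_eq_lintegral (f := w) (μ := μ) (p := 2) (by norm_num)
  simpa only [NNReal.coe_ofNat, ENNReal.coe_ofNat, ENNReal.rpow_ofNat] using h

theorem eLpNorm_two_sq (w : Ω → ℝ) :
    eLpNorm w 2 μ ^ 2 = ∫⁻ z, ENNReal.ofReal (w z ^ 2) ∂μ := by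
  rw [eLpNorm_two_sq_enorm]
  refine lintegral_congr fun z => ?_
  rw [Real.enorm_eq_ofReal_abs, ← ENNReal.ofReal_pow (abs_nonneg _), sq_abs]

theorem lintegral_ofReal_sq {w : Ω → ℝ} (hw : MemLp w 2 μ) :
    ∫⁻ z, ENNReal.ofReal (w z ^ 2) ∂μ = ENNReal.ofReal (∫ z, w z ^ 2 ∂μ) :=
  (ofReal_integral_eq_lintegral_ofReal hw.integrable_sq (.of_forall fun _ => sq_nonneg _)).symm

theorem memLp_two_of_lintegral_ne_top {w : Ω → ℝ} (hw : AEStronglyMeasurable w μ)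
    (h : ∫⁻ z, ENNReal.ofReal (w z ^ 2) ∂μ ≠ ∞) : MemLp w 2 μ := by
  refine ⟨hw, ?_⟩
  rw [← eLpNorm_two_sq] at h
  exact lt_of_le_of_ne le_top fun h' => h (by simp [h'])

end L2

/-! ### Translates of Sobolev functions -/

section Sobolev

variable {p : ℕ} {f : EuclideanSpace ℝ (Fin p) → ℝ}
  {g : EuclideanSpace ℝ (Fin p) → EuclideanSpace ℝ (Fin p)}

/-- The `L²` norm is determined by testing against smooth functions with compact support. -/
theorem eLpNorm_two_le_of_forall_integral_mul_le {w : EuclideanSpace ℝ (Fin p) → ℝ}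
    (hw : MemLp w 2 volume) {C : ℝ} (hC : 0 ≤ C)
    (h : ∀ φ : EuclideanSpace ℝ (Fin p) → ℝ, ContDiff ℝ (⊤ : ℕ∞) φ → HasCompactSupport φ →
      ∫ y, w y * φ y ≤ C * (eLpNorm φ 2 volume).toReal) :
    eLpNorm w 2 volume ≤ ENNReal.ofReal C := by
  have key : ∀ x : Lp ℝ 2 (volume : Measure (EuclideanSpace ℝ (Fin p))),
      inner ℝ (hw.toLp w) x ≤ C * ‖x‖ := by
    have hcl : IsClosed {x : Lp ℝ 2 (volume : Measure (EuclideanSpace ℝ (Fin p))) |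
        inner ℝ (hw.toLp w) x ≤ C * ‖x‖} :=
      isClosed_le (by fun_prop) (by fun_prop)
    intro x
    refine hcl.closure_subset_iff.2 ?_
      (Lp.dense_hasCompactSupport_contDiff (F := ℝ) (p := 2)
        (μ := (volume : Measure (EuclideanSpace ℝ (Fin p)))) (by simp) x)
    rintro y ⟨φ, hy, hφc, hφ⟩
    have hφm : MemLp φ 2 (volume : Measure (EuclideanSpace ℝ (Fin p))) :=
      hφ.continuous.memLp_of_hasCompactSupport hφc
    have : y = hφm.toLp φ := by
      refine Lp.ext ?_
      exact hy.trans hφm.coeFn_toLp.symm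
    simp only [Set.mem_ofPred_eq]
    rw [this, inner_toLp_eq_integral, Lp.norm_toLp]
    exact h φ hφ hφc
  have h1 := key (hw.toLp w)
  rw [real_inner_self_eq_norm_mul_norm] at h1
  have h2 : ‖hw.toLp w‖ ≤ C := by
    by_contra! hlt
    have : 0 < ‖hw.toLp w‖ := hC.trans_lt hlt
    nlinarith
  rw [Lp.norm_toLp] at h2
  rw [← ENNReal.ofReal_toReal hw.eLpNorm_ne_top]
  exact ENNReal.ofReal_le_ofReal h2

/-- Any two versions of the weak gradient agree almost everywhere. -/
theorem HasWeakGradient.ae_eq (hg : HasWeakGradient f g)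
    {g' : EuclideanSpace ℝ (Fin p) → EuclideanSpace ℝ (Fin p)} (hg' : HasWeakGradient f g') :
    g =ᵐ[volume] g' := by
  have h : ∀ i : Fin p, ∀ᵐ y, g y i = g' y i := by
    intro i
    have hloc : ∀ {k : EuclideanSpace ℝ (Fin p) → EuclideanSpace ℝ (Fin p)},
        LocallyIntegrable k volume → LocallyIntegrable (fun y => k y i) volume := by
      intro k hk x
      obtain ⟨s, hs, hi⟩ := hk x
      exact ⟨s, hs, hi.eval_piLp i⟩
    refine ae_eq_of_integral_contDiff_smul_eq (hloc hg.2.1) (hloc hg'.2.1) fun φ hφ hφc => ?_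
    have h1 := hg.2.2 φ hφ hφc (EuclideanSpace.single i 1)
    have h2 := hg'.2.2 φ hφ hφc (EuclideanSpace.single i 1)
    simp only [EuclideanSpace.inner_single_right, one_mul, conj_trivial] at h1 h2
    simp only [smul_eq_mul, mul_comm (φ _)]
    linarith
  filter_upwards [ae_all_iff.2 h] with y hy
  exact PiLp.ext hy

theorem HasWeakGradient.congr (hg : HasWeakGradient f g)
    {g' : EuclideanSpace ℝ (Fin p) → EuclideanSpace ℝ (Fin p)} (h : g =ᵐ[volume] g') :
    HasWeakGradient f g' := by
  refine ⟨hg.1, fun x => ?_, fun φ hφ hφc v => ?_⟩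
  · obtain ⟨s, hs, hi⟩ := hg.2.1 x
    exact ⟨s, hs, hi.congr (ae_restrict_of_ae h)⟩
  · rw [hg.2.2 φ hφ hφc v]
    congr 1
    refine integral_congr_ae ?_
    filter_upwards [h] with y hy
    simp [hy]

/-- Translating a test function along `v` and differentiating moves the derivative onto the weak
gradient. -/
theorem HasWeakGradient.hasDerivAt_integral_mul_translate (hg : HasWeakGradient f g)
    {φ : EuclideanSpace ℝ (Fin p) → ℝ} (hφ : ContDiff ℝ (⊤ : ℕ∞) φ) (hφc : HasCompactSupport φ)
    (v : EuclideanSpace ℝ (Fin p)) (t : ℝ) :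
    HasDerivAt (fun t : ℝ => ∫ y, f y * φ (y - t • v))
      (∫ y, inner ℝ (g y) v * φ (y - t • v)) t := by
  set ψ : EuclideanSpace ℝ (Fin p) → ℝ := fun z => φ (-z) with hψ_def
  have hψ : ContDiff ℝ (⊤ : ℕ∞) ψ := hφ.comp contDiff_neg
  have hψc : HasCompactSupport ψ := hφc.comp_homeomorph (Homeomorph.neg _)
  have h1 := (HasCompactSupport.hasFDerivAt_convolution_right (ContinuousLinearMap.mul ℝ ℝ)
    (μ := volume) hψc hg.1 (𝕜 := ℝ) (hψ.of_le (by exact_mod_cast le_top)) (t • v)).comp_hasDerivAt t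
      ((hasDerivAt_id t).smul_const v)
  have hcomp : HasCompactSupport fun y => φ (y - t • v) :=
    hφc.comp_homeomorph (Homeomorph.subRight (t • v))
  have h2 := hg.2.2 (fun y => φ (y - t • v)) (hφ.comp (contDiff_id.sub contDiff_const)) hcomp v
  have hψ' : Continuous (fderiv ℝ ψ) := hψ.continuous_fderiv (by simp)
  convert! h1 using 1
  · ext s
    simp [convolution, hψ_def]
  · rw [one_smul, convolution_precompR_apply _ hg.1 (hψc.fderiv (𝕜 := ℝ)) hψ', eq_comm, ← neg_eq_iff_eq_neg.2 h2,
      ← integral_neg]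
    refine integral_congr_ae (.of_forall fun y => ?_)
    have e1 : fderiv ℝ ψ (t • v - y) v = - fderiv ℝ φ (y - t • v) v := by
      have hd : HasFDerivAt φ (fderiv ℝ φ (-(t • v - y))) (-(t • v - y)) :=
        (hφ.differentiable (by simp) _).hasFDerivAt
      have := hd.comp (t • v - y) (hasFDerivAt_id (t • v - y)).neg
      rw [show ψ = φ ∘ fun z => -z from rfl]
      erw [this.fderiv]
      simp
    have e2 : fderiv ℝ (fun y => φ (y - t • v)) y = fderiv ℝ φ (y - t • v) := by
      rw [fderiv_comp_sub]
    simp [e1, e2]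

theorem memLp_translate {F : Type*} [NormedAddCommGroup F]
    {k : EuclideanSpace ℝ (Fin p) → F} (hk : MemLp k 2 volume)
    (w : EuclideanSpace ℝ (Fin p)) : MemLp (fun y => k (y + w)) 2 volume :=
  hk.comp_measurePreserving (measurePreserving_add_right volume w)

theorem memLp_inner_const {F : Type*} [NormedAddCommGroup F] [InnerProductSpace ℝ F]
    {Ω : Type*} [MeasurableSpace Ω] {μ : Measure Ω} {k : Ω → F} {r : ℝ≥0∞} (hk : MemLp k r μ)
    (v : F) : MemLp (fun y => inner ℝ (k y) v) r μ := by
  have := (innerSL ℝ v).comp_memLp' hk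
  refine this.ae_eq (.of_forall fun y => ?_)
  simp [real_inner_comm]

/-- A Taylor estimate in `L²` for translates of a Sobolev function, with an arbitrary
approximation `k` of the directional derivatives along the segment. -/
theorem HasWeakGradient.eLpNorm_translate_sub_le (h : HasWeakGradient f g)
    (hf : MemLp f 2 volume) (hg : MemLp g 2 volume) (v : EuclideanSpace ℝ (Fin p))
    {k : EuclideanSpace ℝ (Fin p) → ℝ} (hk : MemLp k 2 volume) {C : ℝ≥0∞}
    (hC : ∀ t ∈ Set.Icc (0 : ℝ) 1,
      eLpNorm (fun y => inner ℝ (g (y + t • v)) v - k y) 2 volume ≤ C) :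
    eLpNorm (fun y => f (y + v) - f y - k y) 2 volume ≤ C := by
  rcases eq_or_ne C ∞ with rfl | hCt
  · exact le_top
  rw [← ENNReal.ofReal_toReal hCt]
  have hfv := memLp_translate hf v
  refine eLpNorm_two_le_of_forall_integral_mul_le ((hfv.sub hf).sub hk) ENNReal.toReal_nonneg
    fun φ hφ hφc => ?_
  have hφm : MemLp φ 2 (volume : Measure (EuclideanSpace ℝ (Fin p))) :=
    hφ.continuous.memLp_of_hasCompactSupport hφc
  have hint : ∀ {w : EuclideanSpace ℝ (Fin p) → ℝ}, MemLp w 2 volume →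
      Integrable (fun y => w y * φ y) volume := fun hw => hw.integrable_mul hφm
  -- the mean value inequality for this function of one variable is the claim tested against `φ`
  let χ : ℝ → ℝ := fun t => (∫ y, f y * φ (y - t • v)) - t * ∫ y, k y * φ y
  have hχ : ∀ t : ℝ, HasDerivAt χ
      (∫ y, (inner ℝ (g (y + t • v)) v - k y) * φ y) t := by
    intro t
    have h1 := (h.hasDerivAt_integral_mul_translate hφ hφc v t).sub
      ((hasDerivAt_id t).mul_const (∫ y, k y * φ y))
    convert! h1 using 1
    rw [one_mul, ← integral_add_right_eq_self (fun y => inner ℝ (g y) v * φ (y - t • v)) (t • v)]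
    simp only [add_sub_cancel_right]
    rw [← integral_sub (hint (memLp_inner_const (memLp_translate hg _) v)) (hint hk)]
    simp only [sub_mul]
  have hb : ∀ t ∈ Set.Icc (0 : ℝ) 1, ‖∫ y, (inner ℝ (g (y + t • v)) v - k y) * φ y‖
      ≤ C.toReal * (eLpNorm φ 2 volume).toReal := by
    intro t ht
    refine (abs_integral_mul_le
      ((memLp_inner_const (memLp_translate hg _) v).sub hk) hφm).trans ?_
    gcongr
    exact hC t ht
  have hmv := norm_image_sub_le_of_norm_deriv_le_segment_01' (f := χ)
    (fun t _ => (hχ t).hasDerivWithinAt) fun t ht => hb t ⟨ht.1, ht.2.le⟩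
  have hval : χ 1 - χ 0 = ∫ y, (f (y + v) - f y - k y) * φ y := by
    have e1 := integral_sub ((hint hfv).sub (hint hf)) (hint hk)
    have e2 := integral_sub (hint hfv) (hint hf)
    have e3 := integral_add_right_eq_self (μ := volume) (fun y => f y * φ (y - v)) v
    simp only [add_sub_cancel_right] at e3
    simp only [Pi.sub_apply, e2, e3] at e1
    simp only [sub_mul, e1]
    simp [χ]
    ring
  refine le_trans (le_of_eq ?_) ((le_abs_self _).trans hmv)
  exact hval.symm

/-- Sobolev functions are Lipschitz in `L²` under translation. -/
theorem HasWeakGradient.eLpNorm_translate_sub_le_inner (h : HasWeakGradient f g)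
    (hf : MemLp f 2 volume) (hg : MemLp g 2 volume) (v : EuclideanSpace ℝ (Fin p)) :
    eLpNorm (fun y => f (y + v) - f y) 2 volume ≤
      eLpNorm (fun y => inner ℝ (g y) v) 2 volume := by
  have h0 := h.eLpNorm_translate_sub_le hf hg v (k := 0) MemLp.zero'
    (C := eLpNorm (fun y => inner ℝ (g y) v) 2 volume) fun t _ => le_of_eq ?_
  · simpa using h0
  · simp only [Pi.zero_apply, sub_zero]
    exact eLpNorm_comp_measurePreserving (memLp_inner_const hg v).1
      (measurePreserving_add_right volume (t • v))

theorem tendsto_eLpNorm_translate_sub {k : EuclideanSpace ℝ (Fin p) → ℝ}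
    (hk : MemLp k 2 volume) (v : EuclideanSpace ℝ (Fin p)) :
    Tendsto (fun t : ℝ => eLpNorm (fun y => k (y + t • v) - k y) 2 volume) (𝓝 0) (𝓝 0) := by
  let τ : ℝ → C(EuclideanSpace ℝ (Fin p), EuclideanSpace ℝ (Fin p)) :=
    fun t => ⟨fun y => y + t • v, by fun_prop⟩
  have hτ : Continuous τ :=
    ContinuousMap.continuous_of_continuous_uncurry _ (by simp [τ, Function.uncurry_def]; fun_prop)
  have hmp : ∀ t, MeasurePreserving (τ t) volume volume :=
    fun t => measurePreserving_add_right volume (t • v)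
  have hc : Continuous fun t => Lp.compMeasurePreserving (τ t) (hmp t) (hk.toLp k) :=
    continuous_const.compMeasurePreservingLp hτ hmp (by simp)
  have h1 : Tendsto (fun t => edist (Lp.compMeasurePreserving (τ t) (hmp t) (hk.toLp k))
      (Lp.compMeasurePreserving (τ 0) (hmp 0) (hk.toLp k))) (𝓝 0) (𝓝 0) :=
    tendsto_iff_edist_tendsto_0.1 (hc.tendsto 0)
  refine h1.congr fun t => ?_
  rw [Lp.edist_def]
  refine eLpNorm_congr_ae ?_
  have e : ∀ t, ⇑(Lp.compMeasurePreserving (τ t) (hmp t) (hk.toLp k)) =ᵐ[volume]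
      fun y => k (y + t • v) := fun t =>
    (Lp.coeFn_compMeasurePreserving _ (hmp t)).trans
      ((hmp t).quasiMeasurePreserving.ae_eq_comp hk.coeFn_toLp)
  filter_upwards [e t, e 0] with y h1 h2
  rw [Pi.sub_apply, h1, h2]
  simp

/-- A Sobolev function is differentiable in `L²` along every direction. -/
theorem HasWeakGradient.tendsto_eLpNorm_slope_sub (h : HasWeakGradient f g)
    (hf : MemLp f 2 volume) (hg : MemLp g 2 volume) (v : EuclideanSpace ℝ (Fin p)) :
    Tendsto (fun s : ℝ => eLpNorm (fun y => s⁻¹ * (f (y + s • v) - f y) - inner ℝ (g y) v) 2 volume)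
      (𝓝[≠] 0) (𝓝 0) := by
  have hgv := memLp_inner_const hg v
  rw [ENNReal.tendsto_nhds_zero]
  intro ε hε
  have hev := ENNReal.tendsto_nhds_zero.1 (tendsto_eLpNorm_translate_sub hgv v) ε hε
  obtain ⟨δ, hδ, hball⟩ := Metric.eventually_nhds_iff.1 hev
  have hδ' : ∀ᶠ s : ℝ in 𝓝[≠] 0, dist s 0 < δ :=
    eventually_nhdsWithin_of_eventually_nhds (Metric.eventually_nhds_iff.2 ⟨δ, hδ, fun _ h => h⟩)
  filter_upwards [hδ', self_mem_nhdsWithin] with s hs hs0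
  have hs0 : s ≠ 0 := hs0
  have h1 := h.eLpNorm_translate_sub_le hf hg (s • v) (k := fun y => s * inner ℝ (g y) v)
    (hgv.const_mul s) (C := ‖s‖ₑ * ε) fun t ht => ?_
  · have e : (fun y => s⁻¹ * (f (y + s • v) - f y) - inner ℝ (g y) v) =
        s⁻¹ • fun y => f (y + s • v) - f y - s * inner ℝ (g y) v := by
      ext y
      simp only [Pi.smul_apply, smul_eq_mul]
      field_simp
    rw [e, eLpNorm_const_smul]
    refine (mul_le_mul_right h1 _).trans (le_of_eq ?_)
    rw [← mul_assoc, ← enorm_mul, inv_mul_cancel₀ hs0]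
    simp
  · have e : (fun y => inner ℝ (g (y + t • s • v)) (s • v) - s * inner ℝ (g y) v) =
        s • fun y => inner ℝ (g (y + (t * s) • v)) v - inner ℝ (g y) v := by
      ext y
      simp only [Pi.smul_apply, smul_eq_mul, inner_smul_right, smul_smul]
      ring
    rw [e, eLpNorm_const_smul]
    refine mul_le_mul_right (hball ?_) _
    rw [dist_zero_right, norm_mul]
    rw [dist_zero_right] at hs
    refine lt_of_le_of_lt ?_ hs
    have : ‖t‖ ≤ 1 := by rw [Real.norm_of_nonneg ht.1]; exact ht.2
    nlinarith [norm_nonneg s]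

/-- The weak gradient of a nonnegative Sobolev function vanishes almost everywhere on the zero set:
there the difference quotients, hence also their `L²` limits, are nonnegative along both `v` and
`-v`. -/
theorem HasWeakGradient.ae_eq_zero_of_eq_zero (h : HasWeakGradient f g)
    (hf : MemLp f 2 volume) (hg : MemLp g 2 volume) (hf0 : ∀ y, 0 ≤ f y) :
    ∀ᵐ y, f y = 0 → g y = 0 := by
  have key : ∀ v, ∀ᵐ y, f y = 0 → 0 ≤ inner ℝ (g y) v := by
    intro v
    -- along a subsequence the `L²` convergence of the difference quotients holds almost everywhere
    let s : ℕ → ℝ := fun n => 1 / ((n : ℝ) + 1)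
    have hs : ∀ n, 0 < s n := fun n => Nat.one_div_pos_of_nat
    have hs0 : Tendsto s atTop (𝓝[≠] 0) :=
      tendsto_nhdsWithin_iff.2 ⟨tendsto_one_div_add_atTop_nhds_zero_nat,
        .of_forall fun n => (hs n).ne'⟩
    have hm := tendstoInMeasure_of_tendsto_eLpNorm (p := 2) (μ := volume) (by simp)
      (f := fun n y => (s n)⁻¹ * (f (y + s n • v) - f y)) (g := fun y => inner ℝ (g y) v)
      (fun n => (((memLp_translate hf _).sub hf).const_mul _).1) (memLp_inner_const hg v).1
      ((h.tendsto_eLpNorm_slope_sub hf hg v).comp hs0)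
    obtain ⟨ns, -, hns⟩ := hm.exists_seq_tendsto_ae
    filter_upwards [hns] with y hy hfy
    refine ge_of_tendsto hy (.of_forall fun n => ?_)
    rw [hfy, sub_zero]
    exact mul_nonneg (inv_nonneg.2 (hs _).le) (hf0 _)
  have hcoord : ∀ i : Fin p, ∀ᵐ y, f y = 0 → g y i = 0 := by
    intro i
    filter_upwards [key (EuclideanSpace.single i 1), key (-EuclideanSpace.single i 1)] with y h1 h2 h0
    have h1 := h1 h0
    have h2 := h2 h0
    simp only [inner_neg_right, EuclideanSpace.inner_single_right, one_mul, conj_trivial] at h1 h2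
    linarith
  filter_upwards [ae_all_iff.2 hcoord] with y hy h0
  exact PiLp.ext fun i => hy i h0

/-- No nonzero finite measure is invariant under a nonzero translation. -/
theorem eq_zero_of_translation_invariant (ρ : Measure (EuclideanSpace ℝ (Fin p)))
    [IsFiniteMeasure ρ] {v : EuclideanSpace ℝ (Fin p)} (hv : v ≠ 0)
    (h : ρ.map (fun y => y + v) = ρ) : ρ = 0 := by
  have hm : ∀ a : ℝ, MeasurableSet {y : EuclideanSpace ℝ (Fin p) | a ≤ inner ℝ y v} := fun a =>
    measurableSet_le measurable_const (by fun_prop)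
  have hvv : 0 < inner ℝ v v := real_inner_self_pos.2 hv
  have hstep : ∀ a : ℝ, ρ {y | a ≤ inner ℝ y v} = ρ {y | a - inner ℝ v v ≤ inner ℝ y v} := by
    intro a
    conv_lhs => rw [← h, Measure.map_apply (by fun_prop) (hm a)]
    congr 1
    ext y
    simp [inner_add_left]
  -- all half-spaces orthogonal to `v` have the same mass, which must be the limit `0`
  have hsteps : ∀ (a : ℝ) (n : ℕ),
      ρ {y | a + n * inner ℝ v v ≤ inner ℝ y v} = ρ {y | a ≤ inner ℝ y v} := by
    intro a n
    induction n with
    | zero => simp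
    | succ n ih =>
      rw [hstep, ← ih]
      congr 2
      ext y
      push_cast
      ring_nf
  have hlim : ∀ a : ℝ, ρ {y | a ≤ inner ℝ y v} = 0 := by
    intro a
    have hanti : Antitone fun n : ℕ =>
        {y : EuclideanSpace ℝ (Fin p) | a + n * inner ℝ v v ≤ inner ℝ y v} := by
      intro n m hnm y hy
      have : (n : ℝ) ≤ m := by exact_mod_cast hnm
      simp only [Set.mem_ofPred_eq] at hy ⊢
      nlinarith
    have ht := tendsto_measure_iInter_atTop (μ := ρ) (fun n => (hm _).nullMeasurableSet) hanti
      ⟨0, measure_ne_top _ _⟩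
    have hempty : ⋂ n : ℕ, {y : EuclideanSpace ℝ (Fin p) | a + n * inner ℝ v v ≤ inner ℝ y v} = ∅ := by
      refine Set.eq_empty_iff_forall_notMem.2 fun y hy => ?_
      simp only [Set.mem_iInter, Set.mem_ofPred_eq] at hy
      obtain ⟨n, hn⟩ := exists_nat_gt ((inner ℝ y v - a) / inner ℝ v v)
      rw [div_lt_iff₀ hvv] at hn
      linarith [hy n]
    rw [hempty, measure_empty] at ht
    exact tendsto_nhds_unique (tendsto_const_nhds.congr fun n => (hsteps a n).symm) ht
  rw [← Measure.measure_univ_eq_zero]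
  have huniv : (Set.univ : Set (EuclideanSpace ℝ (Fin p))) =
      ⋃ n : ℕ, {y | -(n : ℝ) ≤ inner ℝ y v} := by
    refine (Set.eq_univ_of_forall fun y => ?_).symm
    obtain ⟨n, hn⟩ := exists_nat_gt (-(inner ℝ y v))
    exact Set.mem_iUnion.2 ⟨n, by simp only [Set.mem_ofPred_eq]; linarith⟩
  rw [huniv, measure_iUnion_null_iff]
  exact fun n => hlim _

end Sobolev

/-! ### Sums over rows of independent arrays -/

section IIDArrays

variable {Ω : Type*} [MeasurableSpace Ω]

theorem toReal_eLpNorm_two {μ : Measure Ω} {w : Ω → ℝ} (hw : MemLp w 2 μ) :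
    (eLpNorm w 2 μ).toReal = √(∫ z, w z ^ 2 ∂μ) := by
  rw [eq_comm, Real.sqrt_eq_iff_mul_self_eq (integral_nonneg fun _ => sq_nonneg _)
    ENNReal.toReal_nonneg, ← sq, ← ENNReal.toReal_pow, eLpNorm_two_sq, lintegral_ofReal_sq hw,
    ENNReal.toReal_ofReal (integral_nonneg fun _ => sq_nonneg _)]

theorem integral_abs_mul_abs_le {μ : Measure Ω} {w φ : Ω → ℝ} (hw : MemLp w 2 μ)
    (hφ : MemLp φ 2 μ) :
    ∫ z, |w z| * |φ z| ∂μ ≤ √(∫ z, w z ^ 2 ∂μ) * √(∫ z, φ z ^ 2 ∂μ) := by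
  have h := (le_abs_self _).trans (abs_integral_mul_le hw.abs hφ.abs)
  rw [toReal_eLpNorm_two hw.abs, toReal_eLpNorm_two hφ.abs] at h
  simpa using h

theorem tendstoInMeasure_add {Ω' : Type*} [MeasurableSpace Ω'] {μ : Measure Ω'}
    {X Y : ℕ → Ω' → ℝ} {x y : ℝ} (hX : TendstoInMeasure μ X atTop fun _ => x)
    (hY : TendstoInMeasure μ Y atTop fun _ => y) :
    TendstoInMeasure μ (fun N ω => X N ω + Y N ω) atTop fun _ => x + y := by
  rw [tendstoInMeasure_iff_norm] at *
  intro ε hε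
  have h := (hX (ε / 2) (half_pos hε)).add (hY (ε / 2) (half_pos hε))
  rw [add_zero] at h
  refine tendsto_of_tendsto_of_tendsto_of_le_of_le tendsto_const_nhds h (fun _ => zero_le)
    fun N => (measure_mono fun ω hω => ?_).trans (measure_union_le _ _)
  simp only [Set.mem_union, Set.mem_ofPred_eq, Real.norm_eq_abs] at hω ⊢
  by_contra! hlt
  have := abs_add_le (X N ω - x) (Y N ω - y)
  rw [show X N ω + Y N ω - (x + y) = X N ω - x + (Y N ω - y) by ring] at hω
  linarith

/-- The tail estimate `N P(|a| ≥ ε √N) → 0` for a square integrable variable. -/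
theorem tendsto_mul_measure_sqrt_le {μ : Measure Ω} {a : Ω → ℝ} (ham : Measurable a) (ha : MemLp a 2 μ) {ε : ℝ}
    (hε : 0 < ε) :
    Tendsto (fun N : ℕ => N * μ {z | ε * √N ≤ |a z|}) atTop (𝓝 0) := by
  have hmeas : ∀ N : ℕ, MeasurableSet {z | ε * √N ≤ |a z|} := fun N =>
    measurableSet_le measurable_const ham.abs
  have hb : ∫⁻ z, ENNReal.ofReal ((a z / ε) ^ 2) ∂μ ≠ ∞ := by
    rw [lintegral_ofReal_sq (by simpa [div_eq_mul_inv] using ha.mul_const ε⁻¹)]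
    exact ENNReal.ofReal_ne_top
  have hlim := tendsto_lintegral_of_dominated_convergence (μ := μ)
    (F := fun (N : ℕ) => {z | ε * √N ≤ |a z|}.indicator fun z => ENNReal.ofReal ((a z / ε) ^ 2))
    (f := fun _ => 0) (fun z => ENNReal.ofReal ((a z / ε) ^ 2))
    (fun N => ((ham.div_const ε).pow_const 2).ennreal_ofReal.indicator (hmeas N))
    (fun N => .of_forall fun z => Set.indicator_le_self _ _ z) hb
    (.of_forall fun z => by
      refine tendsto_const_nhds.congr' ?_
      have : Tendsto (fun N : ℕ => ε * √(N : ℝ)) atTop atTop :=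
        (Real.tendsto_sqrt_atTop.comp tendsto_natCast_atTop_atTop).const_mul_atTop hε
      filter_upwards [this.eventually_gt_atTop |a z|] with N hN
      rw [Set.indicator_of_notMem]
      simpa using hN)
  rw [lintegral_zero] at hlim
  refine tendsto_of_tendsto_of_tendsto_of_le_of_le tendsto_const_nhds hlim (fun _ => zero_le)
    fun N => ?_
  simp only [lintegral_indicator (hmeas N)]
  rw [← setLIntegral_const]
  refine setLIntegral_mono' (hmeas N) fun z hz => ?_
  rw [← ENNReal.ofReal_natCast]
  refine ENNReal.ofReal_le_ofReal ?_
  have h0 : 0 ≤ ε * √N := by positivity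
  have h1 : (ε * √N) ^ 2 ≤ |a z| ^ 2 := pow_le_pow_left₀ h0 hz 2
  rw [mul_pow, Real.sq_sqrt (Nat.cast_nonneg N), sq_abs] at h1
  rw [div_pow, le_div_iff₀ (by positivity)]
  linarith

theorem measure_ge_abs_le {μ : Measure Ω} {d : Ω → ℝ} (hd : MemLp d 2 μ) {ε : ℝ} (hε : 0 < ε) :
    μ {z | ε ≤ |d z|} ≤ ENNReal.ofReal ((∫ z, d z ^ 2 ∂μ) / ε ^ 2) := by
  have h := mul_meas_ge_le_lintegral₀ (μ := μ) (f := fun z => ENNReal.ofReal (d z ^ 2))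
    (hd.1.aemeasurable.pow_const 2).ennreal_ofReal (ENNReal.ofReal (ε ^ 2))
  rw [lintegral_ofReal_sq hd] at h
  rw [ENNReal.ofReal_div_of_pos (by positivity), ENNReal.le_div_iff_mul_le (by simp [hε.ne'])
    (by simp),
    mul_comm]
  refine le_trans (mul_le_mul_right (measure_mono fun z hz => ?_) _) h
  simp only [Set.mem_ofPred_eq] at hz ⊢
  refine ENNReal.ofReal_le_ofReal ?_
  rw [← sq_abs (d z)]
  exact pow_le_pow_left₀ hε.le hz 2

variable {P : Measure Ω} [IsProbabilityMeasure P]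

theorem integral_infinitePi_eval {φ : Ω → ℝ} (hφ : AEStronglyMeasurable φ P) (i : ℕ) :
    ∫ ω, φ (ω i) ∂(Measure.infinitePi fun _ : ℕ => P) = ∫ z, φ z ∂P := by
  have h := measurePreserving_eval_infinitePi (fun _ : ℕ => P) i
  rw [← h.map_eq] at hφ
  conv_rhs => rw [← h.map_eq, integral_map h.measurable.aemeasurable hφ]

theorem memLp_infinitePi_eval {φ : Ω → ℝ} {r : ℝ≥0∞} (hφ : MemLp φ r P) (i : ℕ) :
    MemLp (fun ω : ℕ → Ω => φ (ω i)) r (Measure.infinitePi fun _ : ℕ => P) :=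
  hφ.comp_measurePreserving (measurePreserving_eval_infinitePi (fun _ : ℕ => P) i)

theorem identDistrib_infinitePi_eval {φ : Ω → ℝ} (hφ : Measurable φ) (i : ℕ) :
    IdentDistrib (fun ω : ℕ → Ω => φ (ω i)) (fun ω => φ (ω 0))
      (Measure.infinitePi fun _ : ℕ => P) (Measure.infinitePi fun _ : ℕ => P) := by
  have h := fun i => measurePreserving_eval_infinitePi (fun _ : ℕ => P) i
  have e : IdentDistrib (Function.eval i : (ℕ → Ω) → Ω) (Function.eval 0)
      (Measure.infinitePi fun _ : ℕ => P) (Measure.infinitePi fun _ : ℕ => P) :=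
    ⟨(h i).measurable.aemeasurable, (h 0).measurable.aemeasurable,
      (h i).map_eq.trans (h 0).map_eq.symm⟩
  exact e.comp hφ

/-- The sum over a row of an i.i.d. array vanishes in probability when the first absolute moments
of the row do so in total. -/
theorem tendstoInMeasure_sum_of_l1 {D : ℕ → Ω → ℝ} (hD : ∀ N, Integrable (D N) P)
    (h : Tendsto (fun N : ℕ => N * ∫ z, |D N z| ∂P) atTop (𝓝 0)) :
    TendstoInMeasure (Measure.infinitePi fun _ : ℕ => P)
      (fun N ω => ∑ i ∈ Finset.range N, D N (ω i)) atTop fun _ => 0 := by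
  have hi : ∀ N i, Integrable (fun ω : ℕ → Ω => D N (ω i)) (Measure.infinitePi fun _ : ℕ => P) :=
    fun N i => memLp_one_iff_integrable.1 (memLp_infinitePi_eval (memLp_one_iff_integrable.2 (hD N)) i)
  have hs : ∀ N, Integrable (fun ω : ℕ → Ω => ∑ i ∈ Finset.range N, D N (ω i))
      (Measure.infinitePi fun _ : ℕ => P) := fun N => integrable_finsetSum _ fun i _ => hi N i
  refine tendstoInMeasure_of_tendsto_eLpNorm (p := 1) (by simp) (fun N => (hs N).1)
    aestronglyMeasurable_const ?_
  have hlim := (ENNReal.tendsto_ofReal h)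
  rw [ENNReal.ofReal_zero] at hlim
  refine tendsto_of_tendsto_of_tendsto_of_le_of_le tendsto_const_nhds hlim (fun _ => zero_le)
    fun N => ?_
  have e : ((fun ω : ℕ → Ω => ∑ i ∈ Finset.range N, D N (ω i)) - fun _ => (0 : ℝ)) =
      fun ω : ℕ → Ω => ∑ i ∈ Finset.range N, D N (ω i) := by ext; simp
  show eLpNorm ((fun ω : ℕ → Ω => ∑ i ∈ Finset.range N, D N (ω i)) - fun _ => (0 : ℝ)) 1 _ ≤ _
  rw [e, eLpNorm_one_eq_lintegral_enorm, ← ofReal_integral_norm_eq_lintegral_enorm (hs N)]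
  refine ENNReal.ofReal_le_ofReal ?_
  calc ∫ ω : ℕ → Ω, ‖∑ i ∈ Finset.range N, D N (ω i)‖ ∂(Measure.infinitePi fun _ : ℕ => P)
      ≤ ∫ ω : ℕ → Ω, ∑ i ∈ Finset.range N, |D N (ω i)| ∂(Measure.infinitePi fun _ : ℕ => P) :=
        integral_mono (hs N).norm (integrable_finsetSum _ fun i _ => (hi N i).abs)
          fun ω => Finset.abs_sum_le_sum_abs _ _
    _ = N * ∫ z, |D N z| ∂P := by
        rw [integral_finsetSum _ fun i _ => (hi N i).abs]
        simp [integral_infinitePi_eval (φ := fun z => |D N z|) (hD N).abs.1]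

/-- A weak law for row-wise i.i.d. arrays whose total variance vanishes in the limit. -/
theorem tendstoInMeasure_sum_of_l2 {D : ℕ → Ω → ℝ} (hDm : ∀ N, Measurable (D N))
    (hD : ∀ N, MemLp (D N) 2 P) {m : ℝ}
    (h2 : Tendsto (fun N : ℕ => N * ∫ z, D N z ^ 2 ∂P) atTop (𝓝 0))
    (h1 : Tendsto (fun N : ℕ => N * ∫ z, D N z ∂P) atTop (𝓝 m)) :
    TendstoInMeasure (Measure.infinitePi fun _ : ℕ => P)
      (fun N ω => ∑ i ∈ Finset.range N, D N (ω i)) atTop fun _ => m := by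
  set Q := Measure.infinitePi fun _ : ℕ => P with hQ
  have hi : ∀ N i, MemLp (fun ω : ℕ → Ω => D N (ω i)) 2 Q :=
    fun N i => memLp_infinitePi_eval (hD N) i
  have hs : ∀ N, MemLp (fun ω : ℕ → Ω => ∑ i ∈ Finset.range N, D N (ω i)) 2 Q :=
    fun N => memLp_finsetSum _ fun i _ => hi N i
  have hmean : ∀ N : ℕ, ∫ ω, ∑ i ∈ Finset.range N, D N (ω i) ∂Q = N * ∫ z, D N z ∂P := by
    intro N
    rw [integral_finsetSum _ fun i _ => (hi N i).integrable one_le_two]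
    simp [hQ, integral_infinitePi_eval (hD N).1]
  have hvar : ∀ N : ℕ, variance (fun ω : ℕ → Ω => ∑ i ∈ Finset.range N, D N (ω i)) Q
      ≤ N * ∫ z, D N z ^ 2 ∂P := by
    intro N
    have hind : iIndepFun (fun (i : ℕ) (ω : ℕ → Ω) => D N (ω i)) Q :=
      iIndepFun_infinitePi (fun _ => hDm N)
    have e := IndepFun.variance_sum (μ := Q) (s := Finset.range N)
      (X := fun (i : ℕ) (ω : ℕ → Ω) => D N (ω i)) (fun i _ => hi N i)
      fun i _ j _ hij => hind.indepFun hij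
    have e' : (∑ i ∈ Finset.range N, fun ω : ℕ → Ω => D N (ω i)) =
        fun ω : ℕ → Ω => ∑ i ∈ Finset.range N, D N (ω i) := by ext; simp
    rw [← e', e]
    refine (Finset.sum_le_card_nsmul _ _ (∫ z, D N z ^ 2 ∂P) fun i _ => ?_).trans (by simp)
    refine (variance_le_expectation_sq (hi N i).1).trans (le_of_eq ?_)
    exact integral_infinitePi_eval (φ := fun z => D N z ^ 2) ((hD N).1.pow 2) i
  rw [tendstoInMeasure_iff_norm]
  intro ε hε
  have hlim : Tendsto (fun N : ℕ => ENNReal.ofReal ((N * ∫ z, D N z ^ 2 ∂P) / (ε / 2) ^ 2))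
      atTop (𝓝 0) := by
    have := ENNReal.tendsto_ofReal (h2.div_const ((ε / 2) ^ 2))
    simpa using this
  have hev : ∀ᶠ N : ℕ in atTop, |N * ∫ z, D N z ∂P - m| < ε / 2 := by
    have := (Metric.tendsto_nhds.1 h1) (ε / 2) (half_pos hε)
    simpa [Real.dist_eq] using this
  refine tendsto_of_tendsto_of_tendsto_of_le_of_le' tendsto_const_nhds hlim
    (.of_forall fun _ => zero_le) ?_
  filter_upwards [hev] with N hN
  refine le_trans (measure_mono fun ω hω => ?_)
    ((meas_ge_le_variance_div_sq (hs N) (half_pos hε)).trans (ENNReal.ofReal_le_ofReal ?_))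
  · simp only [Set.mem_ofPred_eq, Real.norm_eq_abs, hmean] at hω ⊢
    have := abs_sub_le (∑ i ∈ Finset.range N, D N (ω i)) (N * ∫ z, D N z ∂P) m
    linarith
  · gcongr
    exact hvar N

theorem tendsto_measure_exists_ge {B : ℕ → Set Ω} (hB : ∀ N, MeasurableSet (B N))
    (h : Tendsto (fun N : ℕ => N * P (B N)) atTop (𝓝 0)) :
    Tendsto (fun N : ℕ => (Measure.infinitePi fun _ : ℕ => P)
      {ω | ∃ i ∈ Finset.range N, ω i ∈ B N}) atTop (𝓝 0) := by
  refine tendsto_of_tendsto_of_tendsto_of_le_of_le tendsto_const_nhds h (fun _ => zero_le)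
    fun N => ?_
  have e : {ω : ℕ → Ω | ∃ i ∈ Finset.range N, ω i ∈ B N} =
      ⋃ i ∈ Finset.range N, Function.eval i ⁻¹' B N := by ext; simp
  simp only [e]
  refine (measure_biUnion_finset_le _ _).trans ?_
  refine (Finset.sum_le_card_nsmul _ _ (P (B N)) fun i _ => le_of_eq ?_).trans (by simp)
  exact (measurePreserving_eval_infinitePi (fun _ : ℕ => P) i).measure_preimage
    (hB N).nullMeasurableSet

end IIDArrays

/-! ### Second order expansion of sums of logarithms -/

section Expansion

variable {Ω : Type*} [MeasurableSpace Ω] {P : Measure Ω}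
  {T : ℕ → Ω → ℝ} {a : Ω → ℝ}

theorem abs_two_mul_log_one_add_sub_le {x ε : ℝ} (hε : ε ≤ 1 / 2) (hx : |x| ≤ ε) :
    |2 * Real.log (1 + x) - (2 * x - x ^ 2)| ≤ 4 * ε * x ^ 2 := by
  have hx1 : |x| ≤ 1 / 2 := hx.trans hε
  have h := Real.abs_log_sub_add_sum_range_le (x := -x) (by rw [abs_neg]; linarith) 2
  simp only [Finset.sum_range_succ, Finset.sum_range_zero, abs_neg, sub_neg_eq_add] at h
  norm_num at h
  have h3 : |x| ^ 3 / (1 - |x|) ≤ 2 * ε * x ^ 2 := by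
    rw [div_le_iff₀ (by linarith), ← sq_abs x]
    have h0 := abs_nonneg x
    have h4 : |x| ^ 3 ≤ ε * |x| ^ 2 := by nlinarith [sq_nonneg |x|]
    have h5 : 0 ≤ ε * |x| ^ 2 := by have := h0.trans hx; positivity
    nlinarith
  have e : 2 * Real.log (1 + x) - (2 * x - x ^ 2) = 2 * (-x + x ^ 2 / 2 + Real.log (1 + x)) := by
    ring
  rw [e, abs_mul, abs_two]
  linarith

/-- Uniform asymptotic negligibility of the entries of the array. -/
theorem tendsto_mul_measure_ge (ham : Measurable a) (hT : ∀ N, MemLp (T N) 2 P)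
    (ha : MemLp a 2 P)
    (h2 : Tendsto (fun N : ℕ => (N : ℝ) * ∫ z, (T N z - a z / (2 * √N)) ^ 2 ∂P) atTop (𝓝 0))
    {ε : ℝ} (hε : 0 < ε) :
    Tendsto (fun N : ℕ => N * P {z | ε ≤ |T N z|}) atTop (𝓝 0) := by
  have hb : ∀ N : ℕ, MemLp (fun z => a z / (2 * √N)) 2 P := fun N => by
    simpa [div_eq_mul_inv] using ha.mul_const (2 * √N)⁻¹
  have h1 : Tendsto (fun N : ℕ => ENNReal.ofReal
      (((N : ℝ) * ∫ z, (T N z - a z / (2 * √N)) ^ 2 ∂P) / (ε / 2) ^ 2)) atTop (𝓝 0) := by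
    simpa using ENNReal.tendsto_ofReal (h2.div_const ((ε / 2) ^ 2))
  have h3 := h1.add (tendsto_mul_measure_sqrt_le ham ha hε)
  rw [add_zero] at h3
  refine tendsto_of_tendsto_of_tendsto_of_le_of_le' tendsto_const_nhds h3
    (.of_forall fun _ => zero_le) ?_
  filter_upwards [eventually_gt_atTop 0] with N hN
  have hN' : 0 < √(N : ℝ) := Real.sqrt_pos.2 (by exact_mod_cast hN)
  have hsub : P {z | ε ≤ |T N z|} ≤ P {z | ε / 2 ≤ |T N z - a z / (2 * √N)|}
      + P {z | ε * √N ≤ |a z|} := by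
    refine (measure_mono fun z hz => ?_).trans (measure_union_le _ _)
    simp only [Set.mem_union, Set.mem_ofPred_eq] at hz ⊢
    by_contra! hlt
    have e : |a z / (2 * √N)| < ε / 2 := by
      rw [abs_div, abs_of_pos (by positivity : 0 < 2 * √(N : ℝ)), div_lt_iff₀ (by positivity)]
      linarith [hlt.2]
    have := abs_add_le (T N z - a z / (2 * √N)) (a z / (2 * √N))
    rw [sub_add_cancel] at this
    linarith [hlt.1]
  refine (mul_le_mul_right hsub _).trans ?_
  rw [mul_add]
  gcongr
  refine (mul_le_mul_right (measure_ge_abs_le ((hT N).sub (hb N)) (half_pos hε)) _).trans ?_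
  rw [← ENNReal.ofReal_natCast, ← ENNReal.ofReal_mul (Nat.cast_nonneg N), mul_div_assoc]
  rfl

variable [IsProbabilityMeasure P]

/-- The sum of squares over a row is asymptotically deterministic. -/
theorem tendstoInMeasure_sum_sq (ham : Measurable a) (hT : ∀ N, MemLp (T N) 2 P)
    (ha : MemLp a 2 P)
    (h2 : Tendsto (fun N : ℕ => (N : ℝ) * ∫ z, (T N z - a z / (2 * √N)) ^ 2 ∂P) atTop (𝓝 0)) :
    TendstoInMeasure (Measure.infinitePi fun _ : ℕ => P)
      (fun N ω => ∑ i ∈ Finset.range N, T N (ω i) ^ 2) atTop fun _ => (∫ z, a z ^ 2 ∂P) / 4 := by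
  have hb : ∀ N : ℕ, MemLp (fun z => a z / (2 * √N)) 2 P := fun N => by
    simpa [div_eq_mul_inv] using ha.mul_const (2 * √N)⁻¹
  have hd : ∀ N : ℕ, MemLp (fun z => T N z - a z / (2 * √N)) 2 P := fun N => (hT N).sub (hb N)
  have hbsq : ∀ N : ℕ, 0 < N → (N : ℝ) * ∫ z, (a z / (2 * √N)) ^ 2 ∂P = (∫ z, a z ^ 2 ∂P) / 4 := by
    intro N hN
    have hN' : (0 : ℝ) < N := by exact_mod_cast hN
    simp only [div_pow, mul_pow, Real.sq_sqrt hN'.le]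
    rw [integral_div]
    field_simp
    norm_num
  -- the squares of the linearized summands obey the strong law
  have hlln : TendstoInMeasure (Measure.infinitePi fun _ : ℕ => P)
      (fun N ω => ∑ i ∈ Finset.range N, (a (ω i) / (2 * √N)) ^ 2) atTop
      fun _ => (∫ z, a z ^ 2 ∂P) / 4 := by
    refine tendstoInMeasure_of_tendsto_ae (fun N => ?_) ?_
    · exact (Finset.measurable_sum _ fun i _ =>
        ((ham.comp (measurable_pi_apply i)).div_const _).pow_const 2).aestronglyMeasurable
    have hsl := strong_law_ae_real (μ := Measure.infinitePi fun _ : ℕ => P)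
      (fun i ω => a (ω i) ^ 2)
      (memLp_infinitePi_eval ha 0).integrable_sq
      (fun i j hij => (iIndepFun_infinitePi (P := fun _ : ℕ => P) (X := fun _ z => a z ^ 2)
        fun _ => ham.pow_const 2).indepFun hij)
      (fun i => identDistrib_infinitePi_eval (ham.pow_const 2) i)
    rw [integral_infinitePi_eval (φ := fun z => a z ^ 2) (ha.1.pow 2)] at hsl
    filter_upwards [hsl] with ω hω
    refine (hω.div_const 4).congr' ?_
    filter_upwards [eventually_gt_atTop 0] with N hN
    have hN' : (0 : ℝ) < N := by exact_mod_cast hN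
    simp only [div_pow, mul_pow, Real.sq_sqrt hN'.le]
    rw [← Finset.sum_div]
    field_simp
    norm_num
  have hrem : TendstoInMeasure (Measure.infinitePi fun _ : ℕ => P)
      (fun N ω => ∑ i ∈ Finset.range N, (T N (ω i) ^ 2 - (a (ω i) / (2 * √N)) ^ 2)) atTop
      fun _ => 0 := by
    refine tendstoInMeasure_sum_of_l1 (D := fun N z => T N z ^ 2 - (a z / (2 * √N)) ^ 2)
      (fun N => (hT N).integrable_sq.sub (hb N).integrable_sq) ?_
    -- `|T² - b²| ≤ (T - b)² + 2 |b| |T - b|`, and Cauchy-Schwarz for the last term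
    have hup : Tendsto (fun N : ℕ => (N : ℝ) * ∫ z, (T N z - a z / (2 * √N)) ^ 2 ∂P +
        2 * (√((∫ z, a z ^ 2 ∂P) / 4) * √((N : ℝ) * ∫ z, (T N z - a z / (2 * √N)) ^ 2 ∂P)))
        atTop (𝓝 0) := by
      have h3 := (Real.continuous_sqrt.tendsto 0).comp h2
      have := h2.add ((h3.const_mul √((∫ z, a z ^ 2 ∂P) / 4)).const_mul 2)
      simpa using this
    refine tendsto_of_tendsto_of_tendsto_of_le_of_le' tendsto_const_nhds hup
      (.of_forall fun N => mul_nonneg (Nat.cast_nonneg N) (integral_nonneg fun _ => abs_nonneg _)) ?_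
    filter_upwards [eventually_gt_atTop 0] with N hN
    have hi1 := (hd N).integrable_sq
    have hi2 : Integrable (fun z => |a z / (2 * √N)| * |T N z - a z / (2 * √N)|) P :=
      (hb N).abs.integrable_mul (hd N).abs
    have hle : ∫ z, |T N z ^ 2 - (a z / (2 * √N)) ^ 2| ∂P ≤
        ∫ z, (T N z - a z / (2 * √N)) ^ 2 ∂P +
          2 * ∫ z, |a z / (2 * √N)| * |T N z - a z / (2 * √N)| ∂P := by
      rw [← integral_const_mul, ← integral_add hi1 (hi2.const_mul 2)]
      refine integral_mono ((hT N).integrable_sq.sub (hb N).integrable_sq).abs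
        (hi1.add (hi2.const_mul 2)) fun z => ?_
      set t := T N z
      set b := a z / (2 * √N)
      have e : t ^ 2 - b ^ 2 = (t - b) ^ 2 + 2 * (b * (t - b)) := by ring
      rw [e, ← abs_mul]
      refine (abs_add_le _ _).trans (le_of_eq ?_)
      rw [abs_of_nonneg (sq_nonneg (t - b)), abs_mul 2, abs_two]
    have hcs := integral_abs_mul_abs_le (hb N) (hd N)
    have hN' : (0 : ℝ) ≤ N := Nat.cast_nonneg N
    rw [← hbsq N hN]
    rw [Real.sqrt_mul hN', Real.sqrt_mul hN']
    have hsq : √(N : ℝ) * √N = N := Real.mul_self_sqrt hN'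
    calc (N : ℝ) * ∫ z, |T N z ^ 2 - (a z / (2 * √N)) ^ 2| ∂P
        ≤ N * (∫ z, (T N z - a z / (2 * √N)) ^ 2 ∂P + 2 *
          (√(∫ z, (a z / (2 * √N)) ^ 2 ∂P) * √(∫ z, (T N z - a z / (2 * √N)) ^ 2 ∂P))) := by
          gcongr
          linarith
      _ = _ := by
        linear_combination (-2 * (√(∫ z, (a z / (2 * √N)) ^ 2 ∂P) *
          √(∫ z, (T N z - a z / (2 * √N)) ^ 2 ∂P))) * hsq
  have h := tendstoInMeasure_add hrem hlln
  rw [zero_add] at h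
  refine h.congr_left fun N => .of_forall fun ω => ?_
  simp only [Finset.sum_sub_distrib]
  ring

theorem tendstoInMeasure_two_mul_sum_sub (hTm : ∀ N, Measurable (T N)) (ham : Measurable a)
    (hT : ∀ N, MemLp (T N) 2 P) (ha : MemLp a 2 P)
    (h2 : Tendsto (fun N : ℕ => (N : ℝ) * ∫ z, (T N z - a z / (2 * √N)) ^ 2 ∂P) atTop (𝓝 0))
    (h1 : Tendsto (fun N : ℕ => (N : ℝ) * ∫ z, T N z ∂P) atTop (𝓝 (-(∫ z, a z ^ 2 ∂P) / 8)))
    (h0 : ∫ z, a z ∂P = 0) :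
    TendstoInMeasure (Measure.infinitePi fun _ : ℕ => P)
      (fun N ω => ∑ i ∈ Finset.range N, 2 * (T N (ω i) - a (ω i) / (2 * √N))) atTop
      fun _ => -(∫ z, a z ^ 2 ∂P) / 4 := by
  have hb : ∀ N : ℕ, MemLp (fun z => a z / (2 * √N)) 2 P := fun N => by
    simpa [div_eq_mul_inv] using ha.mul_const (2 * √N)⁻¹
  refine tendstoInMeasure_sum_of_l2 (D := fun N z => 2 * (T N z - a z / (2 * √N)))
    (fun N => ((hTm N).sub (ham.div_const _)).const_mul 2)
    (fun N => ((hT N).sub (hb N)).const_mul 2) ?_ ?_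
  · have := h2.const_mul 4
    rw [mul_zero] at this
    refine this.congr fun N => ?_
    simp only [mul_pow]
    rw [integral_const_mul]
    ring
  · have := h1.const_mul 2
    rw [show 2 * (-(∫ z, a z ^ 2 ∂P) / 8) = -(∫ z, a z ^ 2 ∂P) / 4 by ring] at this
    refine this.congr fun N => ?_
    rw [integral_const_mul, integral_sub ((hT N).integrable one_le_two)
      ((hb N).integrable one_le_two), integral_div, h0]
    ring

/-- The second order expansion of a sum of logarithms `2 log (1 + T)` over a row of an i.i.d. array
whose entries are, in `L²`, close to `a / (2 √N)`. The sum of the `T` contributes the drift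
`-‖a‖²/4` and the sum of the `T²` another `-‖a‖²/4`. -/
theorem tendstoInMeasure_sum_log (hTm : ∀ N, Measurable (T N)) (ham : Measurable a)
    (hT : ∀ N, MemLp (T N) 2 P) (ha : MemLp a 2 P)
    (h2 : Tendsto (fun N : ℕ => (N : ℝ) * ∫ z, (T N z - a z / (2 * √N)) ^ 2 ∂P) atTop (𝓝 0))
    (h1 : Tendsto (fun N : ℕ => (N : ℝ) * ∫ z, T N z ∂P) atTop (𝓝 (-(∫ z, a z ^ 2 ∂P) / 8)))
    (h0 : ∫ z, a z ∂P = 0) :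
    TendstoInMeasure (Measure.infinitePi fun _ : ℕ => P)
      (fun N ω => ∑ i ∈ Finset.range N, 2 * Real.log (1 + T N (ω i)) -
        (√N)⁻¹ * ∑ i ∈ Finset.range N, a (ω i)) atTop
      fun _ => -(1 / 2) * ∫ z, a z ^ 2 ∂P := by
  set σ := ∫ z, a z ^ 2 ∂P with hσ
  have hσ0 : 0 ≤ σ := integral_nonneg fun _ => sq_nonneg _
  have hU := tendstoInMeasure_two_mul_sum_sub hTm ham hT ha h2 h1 h0
  have hV := tendstoInMeasure_sum_sq ham hT ha h2
  rw [tendstoInMeasure_iff_norm] at *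
  intro δ hδ
  set η : ℝ := min 1 (δ / 4) with hη
  have hη0 : 0 < η := lt_min one_pos (by positivity)
  -- chosen such that `4 ε (σ / 4 + 1) ≤ δ / 4`
  set ε : ℝ := min (1 / 2) (δ / (16 * (σ / 4 + 1))) with hε
  have hε0 : 0 < ε := lt_min (by norm_num) (by positivity)
  have hε2 : ε ≤ 1 / 2 := min_le_left _ _
  have hε3 : 4 * ε * (σ / 4 + 1) ≤ δ / 4 := by
    have : ε ≤ δ / (16 * (σ / 4 + 1)) := min_le_right _ _
    rw [le_div_iff₀ (by positivity)] at this
    linarith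
  have hmax := tendsto_measure_exists_ge (P := P) (B := fun N => {z | ε ≤ |T N z|})
    (fun N => measurableSet_le measurable_const (hTm N).abs)
    (tendsto_mul_measure_ge ham hT ha h2 hε0)
  have hlim := (hmax.add (hU η hη0)).add (hV η hη0)
  simp only [add_zero] at hlim
  refine tendsto_of_tendsto_of_tendsto_of_le_of_le' tendsto_const_nhds hlim
    (.of_forall fun _ => zero_le) ?_
  filter_upwards [eventually_gt_atTop 0] with N hN
  refine le_trans (measure_mono fun ω hω => ?_)
    ((measure_union_le _ _).trans (add_le_add_left (measure_union_le _ _) _))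
  simp only [Set.mem_union, Set.mem_ofPred_eq, Real.norm_eq_abs] at hω ⊢
  by_contra! hlt
  obtain ⟨⟨hl1, hl2⟩, hl3⟩ := hlt
  have hη1 : η ≤ 1 := min_le_left _ _
  have hη2 : η ≤ δ / 4 := min_le_right _ _
  set U := ∑ i ∈ Finset.range N, 2 * (T N (ω i) - a (ω i) / (2 * √N)) with hUd
  set W := ∑ i ∈ Finset.range N, T N (ω i) ^ 2 with hWd
  -- off the exceptional events every `|T|` is below `ε`, so Taylor's formula applies termwise
  have hlog : |∑ i ∈ Finset.range N, (2 * Real.log (1 + T N (ω i)) -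
      (2 * T N (ω i) - T N (ω i) ^ 2))| ≤ 4 * ε * W := by
    rw [hWd, Finset.mul_sum]
    refine (Finset.abs_sum_le_sum_abs _ _).trans (Finset.sum_le_sum fun i hi => ?_)
    exact abs_two_mul_log_one_add_sub_le hε2 (hl1 i hi).le
  have hW : 4 * ε * W ≤ δ / 4 := by
    have : W ≤ σ / 4 + 1 := by linarith [(abs_lt.1 hl3).2]
    exact (mul_le_mul_of_nonneg_left this (by positivity)).trans hε3
  have hN' : 0 < √(N : ℝ) := Real.sqrt_pos.2 (by exact_mod_cast hN)
  have e : ∑ i ∈ Finset.range N, 2 * Real.log (1 + T N (ω i)) -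
        (√N)⁻¹ * ∑ i ∈ Finset.range N, a (ω i) - -(1 / 2) * σ =
      ∑ i ∈ Finset.range N, (2 * Real.log (1 + T N (ω i)) - (2 * T N (ω i) - T N (ω i) ^ 2)) +
        (U - -σ / 4) - (W - σ / 4) := by
    have eU : U = 2 * ∑ i ∈ Finset.range N, T N (ω i) - (√N)⁻¹ * ∑ i ∈ Finset.range N, a (ω i) := by
      rw [hUd, Finset.mul_sum, Finset.mul_sum, ← Finset.sum_sub_distrib]
      refine Finset.sum_congr rfl fun i _ => ?_
      field_simp
    simp only [Finset.sum_sub_distrib, ← Finset.mul_sum]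
    rw [eU]
    ring
  rw [e] at hω
  have h3 := abs_sub_le (∑ i ∈ Finset.range N, (2 * Real.log (1 + T N (ω i)) -
    (2 * T N (ω i) - T N (ω i) ^ 2)) + (U - -σ / 4)) 0 (W - σ / 4)
  have h4 := abs_add_le (∑ i ∈ Finset.range N, (2 * Real.log (1 + T N (ω i)) -
    (2 * T N (ω i) - T N (ω i) ^ 2))) (U - -σ / 4)
  simp only [sub_zero, zero_sub, abs_neg] at h3
  linarith

/-- The central limit theorem for the coordinates of an infinite product. -/
theorem tendstoInDistribution_inv_sqrt_mul_sum_eval (ham : Measurable a) (ha : MemLp a 2 P)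
    (h0 : ∫ z, a z ∂P = 0) :
    TendstoInDistribution (fun (N : ℕ) (ω : ℕ → Ω) => (√N)⁻¹ * ∑ i ∈ Finset.range N, a (ω i)) atTop
      id (fun _ => Measure.infinitePi fun _ : ℕ => P)
      (gaussianReal 0 (∫ z, a z ^ 2 ∂P).toNNReal) := by
  have hmean : ∫ ω : ℕ → Ω, a (ω 0) ∂(Measure.infinitePi fun _ : ℕ => P) = 0 := by
    rw [integral_infinitePi_eval ha.1, h0]
  have hvar : variance (fun ω : ℕ → Ω => a (ω 0)) (Measure.infinitePi fun _ : ℕ => P) =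
      ∫ z, a z ^ 2 ∂P := by
    rw [variance_of_integral_eq_zero (X := fun ω : ℕ → Ω => a (ω 0))
      (ham.comp (measurable_pi_apply 0)).aemeasurable hmean]
    exact integral_infinitePi_eval (φ := fun z => a z ^ 2) (ha.1.pow 2) 0
  have h := tendstoInDistribution_inv_sqrt_mul_sum_sub (P := Measure.infinitePi fun _ : ℕ => P)
    (X := fun i ω => a (ω i)) (Y := id) (P' := gaussianReal 0 (∫ z, a z ^ 2 ∂P).toNNReal)
    (by rw [hvar]; exact HasLaw.id) (memLp_infinitePi_eval ha 0)
    (iIndepFun_infinitePi (P := fun _ : ℕ => P) (X := fun _ z => a z) fun _ => ham)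
    (fun i => identDistrib_infinitePi_eval ham i)
  simpa only [hmean, mul_zero, sub_zero] using h

end Expansion

/-! ### Likelihood ratios of product measures -/

section LikelihoodRatio

variable {Ω : Type*} [MeasurableSpace Ω]

instance isProbabilityMeasure_sampleLaw {P : Measure Ω} [IsProbabilityMeasure P] (N : ℕ) :
    IsProbabilityMeasure (sampleLaw P N) :=
  inferInstanceAs (IsProbabilityMeasure (Measure.pi fun _ : Fin N => P))

theorem pi_withDensity {P : Measure Ω} [IsProbabilityMeasure P] {r : Ω → ℝ≥0∞}
    (hr : Measurable r) [IsFiniteMeasure (P.withDensity r)] (N : ℕ) :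
    Measure.pi (fun _ : Fin N => P.withDensity r) =
      (Measure.pi fun _ : Fin N => P).withDensity fun ω => ∏ i, r (ω i) := by
  refine Measure.pi_eq fun s hs => ?_
  rw [withDensity_apply _ (MeasurableSet.univ_pi hs), ← lintegral_indicator (MeasurableSet.univ_pi hs)]
  have e : ((Set.univ.pi s).indicator fun ω : Fin N → Ω => ∏ i, r (ω i)) =
      fun ω => ∏ i, (s i).indicator r (ω i) := by
    classical
    ext ω
    by_cases hω : ω ∈ Set.univ.pi s
    · rw [Set.indicator_of_mem hω]
      exact Finset.prod_congr rfl fun i _ => (Set.indicator_of_mem (hω i (Set.mem_univ i)) _).symm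
    · rw [Set.indicator_of_notMem hω]
      simp only [Set.mem_pi, Set.mem_univ, true_implies, not_forall] at hω
      obtain ⟨i, hi⟩ := hω
      exact (Finset.prod_eq_zero (Finset.mem_univ i) (Set.indicator_of_notMem hi _)).symm
  have hind : iIndepFun (fun (i : Fin N) (ω : Fin N → Ω) => (s i).indicator r (ω i))
      (Measure.pi fun _ : Fin N => P) :=
    iIndepFun_pi fun i => (hr.indicator (hs i)).aemeasurable
  rw [e, lintegral_prod_eq_prod_lintegral_of_indepFun Finset.univ _ hind
    fun i => (hr.indicator (hs i)).comp (measurable_pi_apply i)]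
  refine Finset.prod_congr rfl fun i _ => ?_
  rw [(measurePreserving_eval (fun _ : Fin N => P) i).lintegral_comp (hr.indicator (hs i)),
    lintegral_indicator (hs i), withDensity_apply _ (hs i)]

/-- The density of the absolutely continuous part of a product measure is the product of the
densities of the absolutely continuous parts of the factors. -/
theorem likelihoodRatio_ae_eq {Q P : Measure Ω} [IsProbabilityMeasure Q] [IsProbabilityMeasure P]
    {r : Ω → ℝ≥0∞} (hr : Measurable r) {s : Measure Ω} (hs : s ⟂ₘ P)
    (hQ : Q = s + P.withDensity r) (N : ℕ) :
    likelihoodRatio Q P N =ᵐ[sampleLaw P N] fun ω => ∏ i, r (ω i) := by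
  have hS : MeasurableSet hs.nullSet := hs.measurableSet_nullSet
  -- `P` is carried by `S`, so `Q^N` splits into its restrictions to the box `S^N` and its
  -- complement, which are absolutely continuous and singular with respect to `P^N`
  set S := hs.nullSet with hSd
  have hs0 : s S = 0 := hs.measure_nullSet
  have hP0 : P Sᶜ = 0 := hs.measure_compl_nullSet
  have hle : P.withDensity r ≤ Q := by rw [hQ]; exact Measure.le_add_left le_rfl
  have : IsFiniteMeasure (P.withDensity r) := isFiniteMeasure_of_le Q hle
  have hres : Q.restrict S = P.withDensity r := by
    rw [hQ, Measure.restrict_add, Measure.restrict_eq_zero.2 hs0, zero_add]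
    exact Measure.restrict_eq_self_of_ae_mem
      ((withDensity_absolutelyContinuous P r).ae_le (mem_ae_iff.2 hP0))
  have hbox : MeasurableSet (Set.univ.pi fun _ : Fin N => S) := MeasurableSet.univ_pi fun _ => hS
  refine (Measure.eq_rnDeriv (s := (sampleLaw Q N).restrict (Set.univ.pi fun _ : Fin N => S)ᶜ)
    (Finset.measurable_prod _ fun i _ => hr.comp (measurable_pi_apply i)) ?_ ?_).symm
  · refine ⟨Set.univ.pi fun _ : Fin N => S, hbox, ?_, ?_⟩
    · rw [Measure.restrict_apply hbox, Set.inter_compl_self, measure_empty]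
    · rw [prob_compl_eq_zero_iff hbox]
      refine (Measure.pi_pi _ _).trans ?_
      exact Finset.prod_eq_one fun _ _ => (prob_compl_eq_zero_iff hS).1 hP0
  · have h := pi_withDensity (P := P) hr N
    simp only [← hres] at h
    rw [← Measure.restrict_pi_pi] at h
    change Measure.pi _ = (Measure.pi _).restrict _ +
      (Measure.pi fun _ : Fin N => P).withDensity fun ω => ∏ i, r (ω i)
    rw [← h, add_comm, Measure.restrict_add_restrict_compl hbox]

variable {μ : Measure Ω} {p₀ p₁ : Ω → ℝ}

/-- The Lebesgue decomposition of `p₁ μ` with respect to `p₀ μ`. -/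
theorem withDensity_eq_add (hp₀ : Measurable p₀) (hp₁ : Measurable p₁)
    (hp₀_nonneg : ∀ z, 0 ≤ p₀ z) :
    (μ.withDensity fun z => ENNReal.ofReal (p₁ z)) =
      (μ.restrict {z | p₀ z = 0}).withDensity (fun z => ENNReal.ofReal (p₁ z)) +
        (μ.withDensity fun z => ENNReal.ofReal (p₀ z)).withDensity
          fun z => ENNReal.ofReal (p₁ z / p₀ z) := by
  have hS : MeasurableSet {z | p₀ z = 0} := hp₀ (measurableSet_singleton 0)
  have hr : Measurable fun z => ENNReal.ofReal (p₁ z / p₀ z) := (hp₁.div hp₀).ennreal_ofReal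
  rw [← withDensity_mul _ hp₀.ennreal_ofReal hr,
    ← withDensity_indicator hS, ← withDensity_add_left (hp₁.ennreal_ofReal.indicator hS)]
  congr 1
  ext z
  by_cases hz : p₀ z = 0
  · simp [hz]
  · have hz' : z ∉ {z | p₀ z = 0} := hz
    simp only [Pi.add_apply, Pi.mul_apply, Set.indicator_of_notMem hz', zero_add]
    rw [← ENNReal.ofReal_mul (hp₀_nonneg z), mul_div_cancel₀ _ hz]

theorem mutuallySingular_restrict_withDensity (hp₀ : Measurable p₀) (f : Ω → ℝ≥0∞) :
    (μ.restrict {z | p₀ z = 0}).withDensity f ⟂ₘ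
      μ.withDensity fun z => ENNReal.ofReal (p₀ z) := by
  have hS : MeasurableSet {z | p₀ z = 0} := hp₀ (measurableSet_singleton 0)
  refine ⟨{z | p₀ z = 0}ᶜ, hS.compl, ?_, ?_⟩
  · refine withDensity_absolutelyContinuous _ _ ?_
    rw [Measure.restrict_apply hS.compl, Set.compl_inter_self, measure_empty]
  · rw [compl_compl, withDensity_apply _ hS, setLIntegral_eq_zero_iff hS hp₀.ennreal_ofReal]
    exact .of_forall fun z hz => by
      simp only [Set.mem_ofPred_eq] at hz
      simp [hz]

end LikelihoodRatio

/-! ### Square roots of densities as unit vectors -/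

section RootDensities

/-- For unit vectors with `√N (φ N - φ₀) → α / 2`, the vector `α` is
orthogonal to `φ₀`, and `⟨φ N - φ₀, φ₀⟩ = -‖φ N - φ₀‖² / 2` is of order `1 / N` with an explicit
constant. -/
theorem tendsto_mul_inner_of_norm_eq_one {H : Type*} [NormedAddCommGroup H] [InnerProductSpace ℝ H]
    {φ : ℕ → H} {φ₀ α : H} (hφ : ∀ N, ‖φ N‖ = 1) (hφ₀ : ‖φ₀‖ = 1)
    (h : Tendsto (fun N : ℕ => √(N : ℝ) • (φ N - φ₀)) atTop (𝓝 ((1 / 2 : ℝ) • α))) :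
    Tendsto (fun N : ℕ => (N : ℝ) * inner ℝ (φ N - φ₀) φ₀) atTop (𝓝 (-‖α‖ ^ 2 / 8)) ∧
      inner ℝ α φ₀ = 0 := by
  have hinner : ∀ N : ℕ, (N : ℝ) * inner ℝ (φ N - φ₀) φ₀ =
      -(1 / 2) * ‖√(N : ℝ) • (φ N - φ₀)‖ ^ 2 := by
    intro N
    have e : inner ℝ (φ N - φ₀) φ₀ = -(1 / 2) * ‖φ N - φ₀‖ ^ 2 := by
      rw [norm_sub_sq_real, inner_sub_left, real_inner_self_eq_norm_sq, hφ, hφ₀]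
      ring
    rw [e, norm_smul, mul_pow, Real.norm_of_nonneg (Real.sqrt_nonneg _),
      Real.sq_sqrt (Nat.cast_nonneg N)]
    ring
  have h1 : Tendsto (fun N : ℕ => (N : ℝ) * inner ℝ (φ N - φ₀) φ₀) atTop (𝓝 (-‖α‖ ^ 2 / 8)) := by
    have h2 := ((h.norm).pow 2).const_mul (-(1 / 2) : ℝ)
    rw [norm_smul] at h2
    convert! h2 using 1
    · ext N
      exact hinner N
    · congr 1
      norm_num
      ring
  refine ⟨h1, ?_⟩
  have h3 : Tendsto (fun N : ℕ => inner ℝ (√(N : ℝ) • (φ N - φ₀)) φ₀) atTop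
      (𝓝 (inner ℝ ((1 / 2 : ℝ) • α) φ₀)) := h.inner tendsto_const_nhds
  have h4 : Tendsto (fun N : ℕ => (√(N : ℝ))⁻¹ * ((N : ℝ) * inner ℝ (φ N - φ₀) φ₀)) atTop (𝓝 0) := by
    have := (tendsto_inv_atTop_zero.comp
      (Real.tendsto_sqrt_atTop.comp tendsto_natCast_atTop_atTop)).mul h1
    rw [zero_mul] at this
    exact this
  have h5 := tendsto_nhds_unique (h4.congr' ?_) h3
  · rw [real_inner_smul_left] at h5
    linarith
  · filter_upwards [eventually_gt_atTop 0] with N hN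
    have hN' : 0 < √(N : ℝ) := Real.sqrt_pos.2 (by exact_mod_cast hN)
    rw [real_inner_smul_left, ← mul_assoc]
    congr 1
    rw [inv_mul_eq_div, Real.div_sqrt]

variable {Ω : Type*} [MeasurableSpace Ω] {μ : Measure Ω}

theorem memLp_sqrt {q : Ω → ℝ} (hq : Measurable q) (hq0 : ∀ z, 0 ≤ q z)
    (h : ∫⁻ z, ENNReal.ofReal (q z) ∂μ ≠ ∞) : MemLp (fun z => √(q z)) 2 μ := by
  refine memLp_two_of_lintegral_ne_top hq.sqrt.aestronglyMeasurable ?_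
  simpa only [Real.sq_sqrt (hq0 _)] using h

theorem norm_toLp_sqrt {q : Ω → ℝ} (hq0 : ∀ z, 0 ≤ q z)
    (h : ∫⁻ z, ENNReal.ofReal (q z) ∂μ = 1) (hm : MemLp (fun z => √(q z)) 2 μ) :
    ‖hm.toLp‖ = 1 := by
  have h2 := eLpNorm_two_sq (μ := μ) fun z => √(q z)
  simp only [Real.sq_sqrt (hq0 _), h] at h2
  rw [Lp.norm_toLp, ← pow_left_inj₀ ENNReal.toReal_nonneg zero_le_one two_ne_zero,
    ← ENNReal.toReal_pow, h2]
  simp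

variable {p₀ : Ω → ℝ} {p₁ : ℕ → Ω → ℝ} {a : Ω → ℝ}

theorem memLp_mul_sqrt (hp₀ : Measurable p₀) (hp₀_nonneg : ∀ z, 0 ≤ p₀ z) (ham : Measurable a)
    (ha : MemLp a 2 (μ.withDensity fun z => ENNReal.ofReal (p₀ z))) :
    MemLp (fun z => a z * √(p₀ z)) 2 μ := by
  refine memLp_two_of_lintegral_ne_top (ham.mul hp₀.sqrt).aestronglyMeasurable ?_
  have h := (lintegral_ofReal_sq ha).trans_ne ENNReal.ofReal_ne_top
  rw [lintegral_withDensity_eq_lintegral_mul _ hp₀.ennreal_ofReal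
    (ham.pow_const 2).ennreal_ofReal] at h
  convert! h using 3 with z
  rw [Pi.mul_apply, ← ENNReal.ofReal_mul (hp₀_nonneg z), mul_pow, Real.sq_sqrt (hp₀_nonneg z),
    mul_comm]

theorem integral_withDensity_ofReal (hp₀ : Measurable p₀) (hp₀_nonneg : ∀ z, 0 ≤ p₀ z)
    (f : Ω → ℝ) :
    ∫ z, f z ∂(μ.withDensity fun z => ENNReal.ofReal (p₀ z)) = ∫ z, p₀ z * f z ∂μ := by
  rw [integral_withDensity_eq_integral_toReal_smul hp₀.ennreal_ofReal
    (.of_forall fun _ => ENNReal.ofReal_lt_top)]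
  simp [ENNReal.toReal_ofReal (hp₀_nonneg _)]

theorem memLp_sqrt_div (hp₀ : Measurable p₀) (hp₀_nonneg : ∀ z, 0 ≤ p₀ z) {q : Ω → ℝ}
    (hq : Measurable q) (hq_nonneg : ∀ z, 0 ≤ q z) (h : ∫⁻ z, ENNReal.ofReal (q z) ∂μ ≠ ∞) :
    MemLp (fun z => √(q z / p₀ z)) 2 (μ.withDensity fun z => ENNReal.ofReal (p₀ z)) := by
  refine memLp_two_of_lintegral_ne_top (hq.div hp₀).sqrt.aestronglyMeasurable ?_
  have hr : Measurable fun z => ENNReal.ofReal (√(q z / p₀ z) ^ 2) :=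
    ((hq.div hp₀).sqrt.pow_const 2).ennreal_ofReal
  rw [lintegral_withDensity_eq_lintegral_mul _ hp₀.ennreal_ofReal hr]
  refine ne_top_of_le_ne_top h (lintegral_mono fun z => ?_)
  rw [Pi.mul_apply, ← ENNReal.ofReal_mul (hp₀_nonneg z), Real.sq_sqrt (div_nonneg (hq_nonneg z) (hp₀_nonneg z))]
  refine ENNReal.ofReal_le_ofReal ?_
  rcases eq_or_ne (p₀ z) 0 with hz | hz
  · simpa [hz] using hq_nonneg z
  · rw [mul_div_cancel₀ _ hz]

/-- Quadratic mean differentiability along `1 / √N`, in terms of the ratios `√(p₁ N / p₀) - 1`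
under `p₀ μ`. The drift in the second claim comes from the normalization of the densities. -/
theorem root_ratio_limits (hp₀ : Measurable p₀) (hp₀_nonneg : ∀ z, 0 ≤ p₀ z)
    (hp₀_int : ∫⁻ z, ENNReal.ofReal (p₀ z) ∂μ = 1) (hp₁ : ∀ N, Measurable (p₁ N))
    (hp₁_nonneg : ∀ N z, 0 ≤ p₁ N z) (hp₁_int : ∀ N, ∫⁻ z, ENNReal.ofReal (p₁ N z) ∂μ = 1)
    (ham : Measurable a) (ha : MemLp a 2 (μ.withDensity fun z => ENNReal.ofReal (p₀ z)))
    (hqmd : Tendsto (fun N : ℕ => (N : ℝ≥0∞) * ∫⁻ z, ENNReal.ofReal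
      ((√(p₁ N z) - √(p₀ z) - 1 / √N / 2 * a z * √(p₀ z)) ^ 2) ∂μ) atTop (𝓝 0)) :
    Tendsto (fun N : ℕ => (N : ℝ) * ∫ z, (√(p₁ N z / p₀ z) - 1 - a z / (2 * √N)) ^ 2
        ∂(μ.withDensity fun z => ENNReal.ofReal (p₀ z))) atTop (𝓝 0) ∧
      Tendsto (fun N : ℕ => (N : ℝ) * ∫ z, (√(p₁ N z / p₀ z) - 1)
        ∂(μ.withDensity fun z => ENNReal.ofReal (p₀ z))) atTop
        (𝓝 (-(∫ z, a z ^ 2 ∂(μ.withDensity fun z => ENNReal.ofReal (p₀ z))) / 8)) ∧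
      ∫ z, a z ∂(μ.withDensity fun z => ENNReal.ofReal (p₀ z)) = 0 := by
  have m₀ : MemLp (fun z => √(p₀ z)) 2 μ := memLp_sqrt hp₀ hp₀_nonneg (by simp [hp₀_int])
  have m₁ : ∀ N, MemLp (fun z => √(p₁ N z)) 2 μ := fun N =>
    memLp_sqrt (hp₁ N) (hp₁_nonneg N) (by simp [hp₁_int])
  have mα : MemLp (fun z => a z * √(p₀ z)) 2 μ := memLp_mul_sqrt hp₀ hp₀_nonneg ham ha
  have mrem : ∀ N : ℕ, MemLp (fun z => √(p₁ N z) - √(p₀ z) - 1 / √N / 2 * a z * √(p₀ z)) 2 μ := by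
    intro N
    have := ((m₁ N).sub m₀).sub (mα.const_mul (1 / √N / 2))
    refine this.ae_eq (.of_forall fun z => ?_)
    simp [mul_assoc]
  have hreal : Tendsto (fun N : ℕ => (N : ℝ) * ∫ z,
      (√(p₁ N z) - √(p₀ z) - 1 / √N / 2 * a z * √(p₀ z)) ^ 2 ∂μ) atTop (𝓝 0) := by
    have h := (ENNReal.tendsto_toReal ENNReal.zero_ne_top).comp hqmd
    rw [ENNReal.toReal_zero] at h
    refine h.congr fun N => ?_
    simp only [Function.comp_apply]
    rw [lintegral_ofReal_sq (mrem N), ENNReal.toReal_mul, ENNReal.toReal_natCast,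
      ENNReal.toReal_ofReal (integral_nonneg fun _ => sq_nonneg _)]
  have hconv : Tendsto (fun N : ℕ => √(N : ℝ) • ((m₁ N).toLp - m₀.toLp)) atTop
      (𝓝 ((1 / 2 : ℝ) • mα.toLp)) := by
    rw [tendsto_iff_norm_sub_tendsto_zero]
    have h := (Real.continuous_sqrt.tendsto 0).comp hreal
    rw [Real.sqrt_zero] at h
    refine h.congr' ?_
    filter_upwards [eventually_gt_atTop 0] with N hN
    have hN' : 0 < √(N : ℝ) := Real.sqrt_pos.2 (by exact_mod_cast hN)
    have e : √(N : ℝ) • ((m₁ N).toLp - m₀.toLp) - (1 / 2 : ℝ) • mα.toLp =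
        √(N : ℝ) • (mrem N).toLp := by
      have : (mrem N).toLp = (m₁ N).toLp - m₀.toLp - (1 / √(N : ℝ) / 2) • mα.toLp := by
        rw [← MemLp.toLp_const_smul, ← MemLp.toLp_sub, ← MemLp.toLp_sub]
        refine MemLp.toLp_congr _ _ (.of_forall fun z => ?_)
        simp [mul_assoc]
      rw [this, smul_sub _ (_ - _), smul_smul]
      congr 2
      field_simp
    rw [e, norm_smul, Real.norm_of_nonneg hN'.le, Lp.norm_toLp, toReal_eLpNorm_two (mrem N)]
    simp only [Function.comp_apply]
    rw [Real.sqrt_mul (Nat.cast_nonneg N)]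
  obtain ⟨h1, h2⟩ := tendsto_mul_inner_of_norm_eq_one
    (fun N => norm_toLp_sqrt (hp₁_nonneg N) (hp₁_int N) (m₁ N))
    (norm_toLp_sqrt hp₀_nonneg hp₀_int m₀) hconv
  refine ⟨?_, ?_, ?_⟩
  -- passing from `μ` to `p₀ μ` drops the part of the remainder on `{p₀ = 0}`
  · refine tendsto_of_tendsto_of_tendsto_of_le_of_le' tendsto_const_nhds hreal
      (.of_forall fun N => mul_nonneg (Nat.cast_nonneg N) (integral_nonneg fun _ => sq_nonneg _))
      (.of_forall fun N => ?_)
    refine mul_le_mul_of_nonneg_left ?_ (Nat.cast_nonneg N)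
    rw [integral_withDensity_ofReal hp₀ hp₀_nonneg]
    refine integral_mono_of_nonneg (.of_forall fun z => mul_nonneg (hp₀_nonneg z) (sq_nonneg _))
      (mrem N).integrable_sq (.of_forall fun z => ?_)
    simp only
    rcases eq_or_lt_of_le (hp₀_nonneg z) with hz | hz
    · rw [← hz, zero_mul]
      exact sq_nonneg _
    · refine le_of_eq ?_
      have hs : 0 < √(p₀ z) := Real.sqrt_pos.2 hz
      have e : √(p₁ N z) - √(p₀ z) - 1 / √N / 2 * a z * √(p₀ z) =
          √(p₀ z) * (√(p₁ N z / p₀ z) - 1 - a z / (2 * √N)) := by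
        rw [Real.sqrt_div (hp₁_nonneg N z), mul_sub, mul_sub, mul_div_cancel₀ _ hs.ne']
        ring
      rw [e, mul_pow, Real.sq_sqrt hz.le]
  · have e1 : ‖mα.toLp‖ ^ 2 = ∫ z, a z ^ 2 ∂(μ.withDensity fun z => ENNReal.ofReal (p₀ z)) := by
      rw [← real_inner_self_eq_norm_sq, inner_toLp_eq_integral, integral_withDensity_ofReal hp₀ hp₀_nonneg]
      refine integral_congr_ae (.of_forall fun z => ?_)
      have := Real.mul_self_sqrt (hp₀_nonneg z)
      simp only
      linear_combination a z ^ 2 * this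
    rw [← e1]
    refine h1.congr fun N => ?_
    rw [← MemLp.toLp_sub, inner_toLp_eq_integral, integral_withDensity_ofReal hp₀ hp₀_nonneg]
    congr 1
    refine integral_congr_ae (.of_forall fun z => ?_)
    simp only [Pi.sub_apply]
    rcases eq_or_lt_of_le (hp₀_nonneg z) with hz | hz
    · simp [← hz]
    · have hs : 0 < √(p₀ z) := Real.sqrt_pos.2 hz
      rw [Real.sqrt_div (hp₁_nonneg N z)]
      nth_rewrite 3 [← Real.mul_self_sqrt hz.le]
      field_simp
  · rw [inner_toLp_eq_integral] at h2
    rw [integral_withDensity_ofReal hp₀ hp₀_nonneg, ← h2]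
    refine integral_congr_ae (.of_forall fun z => ?_)
    have := Real.mul_self_sqrt (hp₀_nonneg z)
    simp only
    linear_combination (-a z) * this

end RootDensities

/-! ### Local asymptotic normality from quadratic mean differentiability -/

section LAN

variable {Ω : Type*} [MeasurableSpace Ω]

/-- The law of the first `N` coordinates of an infinite independent sequence. It allows all sample
sizes to be treated on one probability space. -/
theorem measurePreserving_prefix (P : Measure Ω) [IsProbabilityMeasure P] (N : ℕ) :
    MeasurePreserving (fun (ω : ℕ → Ω) (i : Fin N) => ω i) (Measure.infinitePi fun _ : ℕ => P)
      (sampleLaw P N) := by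
  have hm : Measurable fun (ω : ℕ → Ω) (i : Fin N) => ω i :=
    measurable_pi_lambda _ fun i => measurable_pi_apply _
  refine ⟨hm, (Measure.pi_eq fun s hs => ?_).symm⟩
  rw [Measure.map_apply hm (MeasurableSet.univ_pi hs)]
  have e : (fun (ω : ℕ → Ω) (i : Fin N) => ω i) ⁻¹' Set.univ.pi s =
      Set.pi (Finset.range N) fun n => if h : n < N then s ⟨n, h⟩ else Set.univ := by
    ext ω
    simp only [Set.mem_preimage, Set.mem_pi, Set.mem_univ, true_implies, Finset.coe_range,
      Set.mem_Iio]
    constructor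
    · intro h n hn
      rw [dif_pos hn]
      exact h ⟨n, hn⟩
    · intro h i
      have := h i i.2
      rwa [dif_pos i.2] at this
  rw [e, Measure.infinitePi_pi, Finset.prod_range]
  · exact Finset.prod_congr rfl fun i _ => by rw [dif_pos i.2]
  · intro n hn
    rw [dif_pos (Finset.mem_range.1 hn)]
    exact hs _

variable {μ : Measure Ω} {p₀ : Ω → ℝ} {p₁ : ℕ → Ω → ℝ} {a : Ω → ℝ}

theorem measurable_logLR (Q P : Measure Ω) (N : ℕ) : Measurable (logLR Q P N) :=
  Real.measurable_log.comp (Measure.measurable_rnDeriv _ _).ennreal_toReal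

theorem sum_two_mul_log_sqrt {ι : Type*} (s : Finset ι) {x : ι → ℝ} (hx : ∀ i ∈ s, 0 < x i) :
    ∑ i ∈ s, 2 * Real.log (1 + (√(x i) - 1)) = Real.log (∏ i ∈ s, ENNReal.ofReal (x i)).toReal := by
  rw [ENNReal.toReal_prod, Real.log_prod]
  · refine Finset.sum_congr rfl fun i hi => ?_
    rw [add_sub_cancel, Real.log_sqrt (hx i hi).le, ENNReal.toReal_ofReal (hx i hi).le]
    ring
  · intro i hi
    rw [ENNReal.toReal_ofReal (hx i hi).le]
    exact (hx i hi).ne'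

/-- Quadratic mean differentiability along `1 / √N` of densities with respect to a dominating
measure implies the local asymptotic expansion of the likelihood ratios. -/
theorem lan_of_qmd (hp₀ : Measurable p₀) (hp₀_nonneg : ∀ z, 0 ≤ p₀ z)
    (hp₀_int : ∫⁻ z, ENNReal.ofReal (p₀ z) ∂μ = 1) (hp₁ : ∀ N, Measurable (p₁ N))
    (hp₁_nonneg : ∀ N z, 0 ≤ p₁ N z) (hp₁_int : ∀ N, ∫⁻ z, ENNReal.ofReal (p₁ N z) ∂μ = 1)
    {P : Measure Ω} (hP : P = μ.withDensity fun z => ENNReal.ofReal (p₀ z))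
    {Q : ℕ → Measure Ω} (hQ : ∀ N, Q N = μ.withDensity fun z => ENNReal.ofReal (p₁ N z))
    (ham : Measurable a) (ha : MemLp a 2 P)
    (hqmd : Tendsto (fun N : ℕ => (N : ℝ≥0∞) * ∫⁻ z, ENNReal.ofReal
      ((√(p₁ N z) - √(p₀ z) - 1 / √N / 2 * a z * √(p₀ z)) ^ 2) ∂μ) atTop (𝓝 0)) :
    Tendsto (fun N : ℕ => sampleLaw P N {ω | likelihoodRatio (Q N) P N ω = 0}) atTop (𝓝 0) ∧
    (∀ δ > 0, Tendsto (fun N : ℕ => sampleLaw P N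
        {ω | δ ≤ |logLR (Q N) P N ω -
          ((√N)⁻¹ * ∑ i : Fin N, a (ω i) - 1 / 2 * ∫ z, a z ^ 2 ∂P)|}) atTop (𝓝 0)) ∧
    (∀ f : BoundedContinuousFunction ℝ ℝ, Tendsto
      (fun N : ℕ => ∫ ω, f (logLR (Q N) P N ω) ∂(sampleLaw P N)) atTop
      (𝓝 (∫ t, f t ∂(gaussianReal (-(1 / 2) * ∫ z, a z ^ 2 ∂P) (∫ z, a z ^ 2 ∂P).toNNReal)))) := by
  have hPp : IsProbabilityMeasure P := ⟨by rw [hP, withDensity_apply _ .univ]; simpa using hp₀_int⟩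
  have hQp : ∀ N, IsProbabilityMeasure (Q N) := fun N =>
    ⟨by rw [hQ, withDensity_apply _ .univ]; simpa using hp₁_int N⟩
  obtain ⟨h2, h1, h0⟩ := root_ratio_limits hp₀ hp₀_nonneg hp₀_int hp₁ hp₁_nonneg hp₁_int ham
    (hP ▸ ha) hqmd
  rw [← hP] at h2 h1 h0
  -- on the null set `{p₀ = 0}` of `P` the ratio `p₁ N / p₀` takes the junk value `0`
  set T : ℕ → Ω → ℝ := fun N z => √(p₁ N z / p₀ z) - 1 with hT
  have hTm : ∀ N, Measurable (T N) := fun N => ((hp₁ N).div hp₀).sqrt.sub_const 1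
  have hTL : ∀ N, MemLp (T N) 2 P := fun N => by
    have h := memLp_sqrt_div (μ := μ) hp₀ hp₀_nonneg (hp₁ N) (hp₁_nonneg N) (by simp [hp₁_int])
    rw [← hP] at h
    exact h.sub (memLp_const 1)
  set ρ := Measure.infinitePi fun _ : ℕ => P with hρ
  set π : (N : ℕ) → (ℕ → Ω) → Fin N → Ω := fun N ω i => ω i with hπ
  have hmp : ∀ N, MeasurePreserving (π N) ρ (sampleLaw P N) := measurePreserving_prefix P
  set σ := ∫ z, a z ^ 2 ∂P with hσ
  have hLR : ∀ N, ∀ᵐ ω ∂ρ, likelihoodRatio (Q N) P N (π N ω) =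
      ∏ i ∈ Finset.range N, ENNReal.ofReal (p₁ N (ω i) / p₀ (ω i)) := by
    intro N
    have h := likelihoodRatio_ae_eq (Q := Q N) (P := P)
      (r := fun z => ENNReal.ofReal (p₁ N z / p₀ z)) ((hp₁ N).div hp₀).ennreal_ofReal
      (s := (μ.restrict {z | p₀ z = 0}).withDensity fun z => ENNReal.ofReal (p₁ N z))
      (hP ▸ mutuallySingular_restrict_withDensity hp₀ _)
      (by rw [hP, hQ]; exact withDensity_eq_add hp₀ (hp₁ N) hp₀_nonneg) N
    filter_upwards [(hmp N).quasiMeasurePreserving.ae h] with ω hω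
    rw [hω, Finset.prod_range]
  -- the vanishing likelihood ratios and the junk values of the logarithm occur only if some
  -- `T N (ω i) = -1`, hence on an event whose probability tends to `0`
  have hbad := tendsto_measure_exists_ge (P := P) (B := fun N => {z | 1 ≤ |T N z|})
    (fun N => measurableSet_le measurable_const (hTm N).abs)
    (tendsto_mul_measure_ge ham hTL ha h2 one_pos)
  have hgood : ∀ (N : ℕ) (ω : ℕ → Ω), (¬ ∃ i ∈ Finset.range N, ω i ∈ {z | 1 ≤ |T N z|}) →
      ∀ i ∈ Finset.range N, 0 < p₁ N (ω i) / p₀ (ω i) := by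
    intro N ω hω i hi
    by_contra! hle
    refine hω ⟨i, hi, ?_⟩
    simp [hT, Real.sqrt_eq_zero_of_nonpos hle]
  have hrem : TendstoInMeasure ρ (fun N ω => logLR (Q N) P N (π N ω) -
      ∑ i ∈ Finset.range N, 2 * Real.log (1 + T N (ω i))) atTop fun _ => 0 := by
    rw [tendstoInMeasure_iff_norm]
    intro ε hε
    refine tendsto_of_tendsto_of_tendsto_of_le_of_le tendsto_const_nhds hbad
      (fun _ => zero_le) fun N => measure_mono_ae ?_
    filter_upwards [hLR N] with ω hω hmem
    by_contra hnot
    have e := sum_two_mul_log_sqrt (Finset.range N) (hgood N ω hnot)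
    have hmem : ε ≤ ‖logLR (Q N) P N (π N ω) -
      ∑ i ∈ Finset.range N, 2 * Real.log (1 + T N (ω i)) - 0‖ := hmem
    simp only [hT] at hmem
    rw [e, logLR, hω, sub_self, sub_zero, norm_zero] at hmem
    linarith
  have hexp : TendstoInMeasure ρ (fun N ω => logLR (Q N) P N (π N ω) -
      (√N)⁻¹ * ∑ i ∈ Finset.range N, a (ω i)) atTop fun _ => -(1 / 2) * σ := by
    have h := tendstoInMeasure_add hrem (tendstoInMeasure_sum_log hTm ham hTL ha h2 h1 h0)
    rw [zero_add] at h
    refine h.congr_left fun N => .of_forall fun ω => ?_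
    ring
  have hsum_meas : ∀ N : ℕ, Measurable fun ω : ℕ → Ω =>
      (√(N : ℝ))⁻¹ * ∑ i ∈ Finset.range N, a (ω i) := fun N =>
    (Finset.measurable_sum _ fun i _ => ham.comp (measurable_pi_apply i)).const_mul _
  refine ⟨?_, fun δ hδ => ?_, fun f => ?_⟩
  · refine tendsto_of_tendsto_of_tendsto_of_le_of_le tendsto_const_nhds hbad
      (fun _ => zero_le) fun N => ?_
    have hms : MeasurableSet {ω | likelihoodRatio (Q N) P N ω = 0} :=
      (Measure.measurable_rnDeriv _ _) (measurableSet_singleton 0)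
    simp only
    rw [← (hmp N).measure_preimage hms.nullMeasurableSet]
    refine measure_mono_ae ?_
    filter_upwards [hLR N] with ω hω hmem
    by_contra hnot
    have hmem : likelihoodRatio (Q N) P N (π N ω) = 0 := hmem
    rw [hω, Finset.prod_eq_zero_iff] at hmem
    obtain ⟨i, hi, hzero⟩ := hmem
    exact (ENNReal.ofReal_pos.2 (hgood N ω hnot i hi)).ne' hzero
  · rw [tendstoInMeasure_iff_norm] at hexp
    refine (hexp δ hδ).congr fun N => ?_
    have hms : MeasurableSet {ω | δ ≤ |logLR (Q N) P N ω -
        ((√N)⁻¹ * ∑ i : Fin N, a (ω i) - 1 / 2 * σ)|} := by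
      refine measurableSet_le measurable_const (Measurable.abs ?_)
      exact (measurable_logLR _ _ _).sub (((Finset.measurable_sum _ fun i _ =>
        ham.comp (measurable_pi_apply i)).const_mul _).sub_const _)
    rw [← (hmp N).measure_preimage hms.nullMeasurableSet]
    congr 1
    ext ω
    simp only [Set.mem_ofPred_eq, Set.mem_preimage, Real.norm_eq_abs, Finset.sum_range, hπ]
    ring_nf
  · have hd := (tendstoInDistribution_inv_sqrt_mul_sum_eval ham ha h0).add_of_tendstoInMeasure_const
      hexp fun N => (((measurable_logLR _ _ _).comp (hmp N).measurable).sub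
        (hsum_meas N)).aemeasurable
    have ht := (ProbabilityMeasure.tendsto_iff_forall_integral_tendsto.1 hd.tendsto) f
    simp only [ProbabilityMeasure.coe_mk, id_eq] at ht
    rw [gaussianReal_map_add_const, zero_add] at ht
    refine ht.congr fun N => ?_
    have e : ((fun (ω : ℕ → Ω) => (√(N : ℝ))⁻¹ * ∑ i ∈ Finset.range N, a (ω i)) + fun ω =>
        logLR (Q N) P N (π N ω) - (√N)⁻¹ * ∑ i ∈ Finset.range N, a (ω i)) =
        (logLR (Q N) P N) ∘ (π N) := by
      ext ω
      simp
    have hcm : AEStronglyMeasurable f (Measure.map (logLR (Q N) P N) (sampleLaw P N)) :=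
      f.continuous.aestronglyMeasurable
    rw [e, ← Measure.map_map (measurable_logLR _ _ _) (hmp N).measurable, (hmp N).map_eq,
      integral_map (measurable_logLR _ _ _).aemeasurable hcm]

end LAN

/-! ### The Fisher information matrix -/

section Fisher

variable {p : ℕ} {g : EuclideanSpace ℝ (Fin p) → EuclideanSpace ℝ (Fin p)}

theorem integrable_coord_mul_coord (hg : MemLp g 2 volume) (i j : Fin p) :
    Integrable (fun y => g y i * g y j) volume :=
  (hg.eval_piLp i).integrable_mul (hg.eval_piLp j)

theorem inner_fisherMatrix (hg : MemLp g 2 volume) (u w : EuclideanSpace ℝ (Fin p)) :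
    inner ℝ u (Matrix.toEuclideanCLM (n := Fin p) (𝕜 := ℝ) (fisherMatrix g) w) =
      4 * ∫ y, inner ℝ (g y) u * inner ℝ (g y) w := by
  have hint := fun i j => integrable_coord_mul_coord hg i j
  have e : ∀ y, inner ℝ (g y) u * inner ℝ (g y) w =
      ∑ i, ∑ j, (u i * w j) * (g y i * g y j) := by
    intro y
    simp only [PiLp.inner_apply, RCLike.inner_apply, conj_trivial, Finset.sum_mul_sum]
    exact Finset.sum_congr rfl fun i _ => Finset.sum_congr rfl fun j _ => by ring
  simp only [e]
  rw [integral_finsetSum _ fun i _ => integrable_finsetSum _ fun j _ => (hint i j).const_mul _,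
    Finset.mul_sum]
  simp only [PiLp.inner_apply, Matrix.ofLp_toEuclideanCLM, Matrix.mulVec, dotProduct,
    RCLike.inner_apply, conj_trivial, fisherMatrix, Matrix.of_apply]
  refine Finset.sum_congr rfl fun i _ => ?_
  rw [integral_finsetSum _ fun j _ => (hint i j).const_mul _, Finset.mul_sum, Finset.sum_mul]
  refine Finset.sum_congr rfl fun j _ => ?_
  rw [integral_const_mul]
  ring

theorem isHermitian_fisherMatrix : (fisherMatrix g).IsHermitian := by
  ext i j
  simp [fisherMatrix, mul_comm]

/-- The argument is by contradiction:
if `⟨∇√q, v⟩` vanished for some `v ≠ 0`, the law `q dy` would be invariant under translation by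
`v`. -/
theorem posDef_fisherMatrix {q : EuclideanSpace ℝ (Fin p) → ℝ} (hq_meas : Measurable q)
    (hq_nonneg : ∀ y, 0 ≤ q y) (hq_int : ∫⁻ y, ENNReal.ofReal (q y) = 1)
    (hf : MemLp (fun y => √(q y)) 2 volume) (hg : MemLp g 2 volume)
    (h : HasWeakGradient (fun y => √(q y)) g) : (fisherMatrix g).PosDef := by
  refine Matrix.PosDef.of_dotProduct_mulVec_pos isHermitian_fisherMatrix fun x hx => ?_
  set v : EuclideanSpace ℝ (Fin p) := WithLp.toLp 2 x with hv
  have hv0 : v ≠ 0 := fun h0 => hx (by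
    have := congrArg WithLp.ofLp h0
    simpa [hv] using this)
  have e : star x ⬝ᵥ (fisherMatrix g).mulVec x = 4 * ∫ y, inner ℝ (g y) v ^ 2 := by
    have := inner_fisherMatrix hg v v
    simp only [← sq] at this
    rw [← this, EuclideanSpace.inner_eq_star_dotProduct, Matrix.ofLp_toEuclideanCLM, dotProduct_comm]
  rw [e]
  have hnn : 0 ≤ ∫ y, inner ℝ (g y) v ^ 2 := integral_nonneg fun _ => sq_nonneg _
  refine mul_pos (by norm_num) (lt_of_le_of_ne hnn fun h0 => ?_)
  have hgv := memLp_inner_const hg v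
  have hL : eLpNorm (fun y => inner ℝ (g y) v) 2 volume = 0 := by
    have h1 := eLpNorm_two_sq (μ := volume) fun y => inner ℝ (g y) v
    rw [lintegral_ofReal_sq hgv, ← h0, ENNReal.ofReal_zero] at h1
    exact pow_eq_zero_iff two_ne_zero |>.1 h1
  have htr := h.eLpNorm_translate_sub_le_inner hf hg v
  have hm : AEStronglyMeasurable (fun y => √(q (y + v)) - √(q y)) volume :=
    ((memLp_translate hf v).sub hf).1
  rw [hL, le_zero_iff, eLpNorm_eq_zero_iff hm two_ne_zero] at htr
  have htr' : ∀ᵐ y, q (y + v) = q y := by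
    filter_upwards [htr] with y hy
    have hy : √(q (y + v)) = √(q y) := sub_eq_zero.1 hy
    rwa [Real.sqrt_inj (hq_nonneg _) (hq_nonneg _)] at hy
  have hprob : errorLaw q Set.univ = 1 := by
    rw [errorLaw, withDensity_apply _ .univ]
    simpa using hq_int
  have : IsFiniteMeasure (errorLaw q) := ⟨by rw [hprob]; exact ENNReal.one_lt_top⟩
  have hinv : (errorLaw q).map (fun y => y + v) = errorLaw q := by
    ext s hs
    have hm := hq_meas.ennreal_ofReal
    rw [Measure.map_apply (by fun_prop) hs, errorLaw, withDensity_apply _ hs,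
      withDensity_apply _ ((measurable_add_const v) hs)]
    conv_rhs => rw [← (measurePreserving_add_right volume v).map_eq]
    rw [setLIntegral_map hs hm (measurable_add_const v)]
    refine lintegral_congr_ae (ae_restrict_of_ae ?_)
    filter_upwards [htr'] with y hy
    rw [hy]
  have := eq_zero_of_translation_invariant (errorLaw q) hv0 hinv
  rw [this] at hprob
  simp at hprob

theorem fisherMatrix_congr {g' : EuclideanSpace ℝ (Fin p) → EuclideanSpace ℝ (Fin p)}
    (h : g =ᵐ[volume] g') : fisherMatrix g = fisherMatrix g' := by
  ext i j
  simp only [fisherMatrix, Matrix.of_apply]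
  congr 1
  refine integral_congr_ae ?_
  filter_upwards [h] with y hy
  rw [hy]

theorem fisherMatrix_errorLaw {q : EuclideanSpace ℝ (Fin p) → ℝ} (hq_meas : Measurable q)
    (hq_nonneg : ∀ y, 0 ≤ q y) (hg : MemLp g 2 volume) (hz : ∀ᵐ y, √(q y) = 0 → g y = 0)
    (i j : Fin p) :
    Integrable (fun y => g y i / √(q y) * (g y j / √(q y))) (errorLaw q) ∧
      fisherMatrix g i j = 4 * ∫ y, g y i / √(q y) * (g y j / √(q y)) ∂(errorLaw q) := by
  have e : ∀ᵐ y, g y i * g y j = q y * (g y i / √(q y) * (g y j / √(q y))) := by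
    filter_upwards [hz] with y hy
    rcases eq_or_lt_of_le (hq_nonneg y) with h0 | h0
    · have : g y = 0 := hy (by rw [← h0, Real.sqrt_zero])
      simp [this]
    · have hs : 0 < √(q y) := Real.sqrt_pos.2 h0
      nth_rewrite 1 [← Real.mul_self_sqrt h0.le]
      field_simp
  constructor
  · rw [errorLaw, integrable_withDensity_iff_integrable_smul' hq_meas.ennreal_ofReal
      (.of_forall fun _ => ENNReal.ofReal_lt_top)]
    refine (integrable_coord_mul_coord hg i j).congr ?_
    filter_upwards [e] with y hy
    rw [hy, ENNReal.toReal_ofReal (hq_nonneg y), smul_eq_mul]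
  · rw [errorLaw, integral_withDensity_ofReal hq_meas hq_nonneg]
    simp only [fisherMatrix, Matrix.of_apply]
    rw [integral_congr_ae e]

end Fisher

/-! ### The regression model and its score -/

section Model

variable {X : Type*} [MeasurableSpace X] {p : ℕ} {ν : Measure X}
  {q : EuclideanSpace ℝ (Fin p) → ℝ} {g : EuclideanSpace ℝ (Fin p) → EuclideanSpace ℝ (Fin p)}
  {G u : X → EuclideanSpace ℝ (Fin p)}

theorem memLp_inner_prod (hgm : Measurable g) (hg : MemLp g 2 volume) (hum : Measurable u)
    (hu : MemLp u 2 ν) :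
    MemLp (fun z : X × EuclideanSpace ℝ (Fin p) => inner ℝ (g z.2) (u z.1)) 2
      (ν.prod volume) := by
  have hm : Measurable fun z : X × EuclideanSpace ℝ (Fin p) => inner ℝ (g z.2) (u z.1) :=
    (hgm.comp measurable_snd).inner (hum.comp measurable_fst)
  refine memLp_two_of_lintegral_ne_top hm.aestronglyMeasurable ?_
  have h1 := (lintegral_ofReal_sq hu.norm).trans_ne ENNReal.ofReal_ne_top
  have h2 := (lintegral_ofReal_sq hg.norm).trans_ne ENNReal.ofReal_ne_top
  have hle : ∀ z : X × EuclideanSpace ℝ (Fin p), ENNReal.ofReal (inner ℝ (g z.2) (u z.1) ^ 2) ≤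
      ENNReal.ofReal (‖u z.1‖ ^ 2) * ENNReal.ofReal (‖g z.2‖ ^ 2) := by
    intro z
    rw [← ENNReal.ofReal_mul (sq_nonneg _), ← mul_pow, ← sq_abs (inner ℝ _ _)]
    refine ENNReal.ofReal_le_ofReal (pow_le_pow_left₀ (abs_nonneg _) ?_ 2)
    rw [mul_comm]
    exact abs_real_inner_le_norm _ _
  refine ne_top_of_le_ne_top ?_ (lintegral_mono hle)
  rw [lintegral_prod_mul (hum.norm.pow_const 2).ennreal_ofReal.aemeasurable
    (hgm.norm.pow_const 2).ennreal_ofReal.aemeasurable]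
  exact ENNReal.mul_ne_top h1 h2

variable [IsProbabilityMeasure ν]

theorem measurePreserving_shear (hG : Measurable G) :
    MeasurePreserving (fun z : X × EuclideanSpace ℝ (Fin p) => (z.1, G z.1 + z.2))
      (ν.prod volume) (ν.prod volume) :=
  (MeasurePreserving.id ν).skew_product (g := fun x y => G x + y)
    ((hG.comp measurable_fst).add measurable_snd)
    (.of_forall fun x => (measurePreserving_add_left volume (G x)).map_eq)

/-- Passing from the response to the residual preserves the dominating measure. -/
theorem measurePreserving_residual (hG : Measurable G) :
    MeasurePreserving (fun z : X × EuclideanSpace ℝ (Fin p) => (z.1, z.2 - G z.1))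
      (ν.prod volume) (ν.prod volume) := by
  have h := measurePreserving_shear (ν := ν) hG.neg
  simpa only [Pi.neg_apply, neg_add_eq_sub] using h

theorem measurable_regDensity (hq_meas : Measurable q) (hG : Measurable G) :
    Measurable (regDensity q G) :=
  hq_meas.comp (measurable_snd.sub (hG.comp measurable_fst))

theorem regLaw_eq_withDensity (hq_meas : Measurable q) (hG : Measurable G) :
    regLaw ν q G =
      (ν.prod volume).withDensity fun z => ENNReal.ofReal (regDensity q G z) := by
  have hm : Measurable fun z => ENNReal.ofReal (regDensity q G z) :=
    (measurable_regDensity hq_meas hG).ennreal_ofReal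
  have hsh := measurePreserving_shear (ν := ν) hG
  ext s hs
  rw [regLaw, errorLaw, prod_withDensity_right hq_meas.ennreal_ofReal,
    Measure.map_apply hsh.measurable hs, withDensity_apply _ (hsh.measurable hs),
    withDensity_apply _ hs]
  conv_rhs => rw [← hsh.map_eq]
  rw [setLIntegral_map hs hm hsh.measurable]
  simp [regDensity]

theorem lintegral_regDensity (hq_meas : Measurable q) (hq_int : ∫⁻ y, ENNReal.ofReal (q y) = 1)
    (hG : Measurable G) :
    ∫⁻ z, ENNReal.ofReal (regDensity q G z) ∂(ν.prod volume) = 1 := by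
  have hm : Measurable fun z : X × EuclideanSpace ℝ (Fin p) => ENNReal.ofReal (q z.2) :=
    (hq_meas.comp measurable_snd).ennreal_ofReal
  have h := (measurePreserving_residual (ν := ν) hG).lintegral_comp hm
  simp only [regDensity]
  rw [h, lintegral_prod _ hm.aemeasurable]
  simp [hq_int]

theorem ae_residual (hG : Measurable G) {r : EuclideanSpace ℝ (Fin p) → Prop}
    (h : ∀ᵐ y, r y) : ∀ᵐ z ∂(ν.prod volume), r (z.2 - G z.1) :=
  (Measure.quasiMeasurePreserving_snd.comp
    (measurePreserving_residual (ν := ν) hG).quasiMeasurePreserving).ae h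

theorem ae_regLaw_of_ae (hq_meas : Measurable q) (hG : Measurable G)
    {r : X × EuclideanSpace ℝ (Fin p) → Prop} (h : ∀ᵐ z ∂(ν.prod volume), r z) :
    ∀ᵐ z ∂(regLaw ν q G), r z := by
  rw [regLaw_eq_withDensity hq_meas hG]
  exact (withDensity_absolutelyContinuous _ _).ae_le h

theorem measurable_scoreFun (hq_meas : Measurable q) (hgm : Measurable g) (hG : Measurable G)
    (hu : Measurable u) : Measurable (scoreFun q g G u) := by
  have hd := measurable_regDensity (X := X) hq_meas hG
  refine Measurable.indicator ?_ (measurableSet_lt measurable_const hd)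
  have h1 : Measurable fun z : X × EuclideanSpace ℝ (Fin p) => g (z.2 - G z.1) :=
    hgm.comp (measurable_snd.sub (hG.comp measurable_fst))
  exact ((h1.inner (hu.comp measurable_fst)).const_mul (-2)).div hd.sqrt

/-- The indicator in the score is harmless because the weak gradient of `√q` vanishes where `q`
does. -/
theorem scoreFun_mul_sqrt (hq_nonneg : ∀ y, 0 ≤ q y) (hz : ∀ᵐ y, √(q y) = 0 → g y = 0)
    (hG : Measurable G) :
    ∀ᵐ z ∂(ν.prod volume), scoreFun q g G u z * √(regDensity q G z) =
      -2 * inner ℝ (g (z.2 - G z.1)) (u z.1) := by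
  filter_upwards [ae_residual hG hz] with z hz
  unfold scoreFun
  rcases eq_or_lt_of_le (hq_nonneg (z.2 - G z.1)) with h0 | h0
  · have h1 : g (z.2 - G z.1) = 0 := hz (by rw [← h0, Real.sqrt_zero])
    rw [Set.indicator_of_notMem (by simp [regDensity, ← h0]), h1]
    simp
  · rw [Set.indicator_of_mem (by simpa [regDensity] using h0)]
    have : √(regDensity q G z) ≠ 0 := (Real.sqrt_pos.2 h0).ne'
    rw [div_mul_cancel₀ _ this]

theorem memLp_withDensity_of_mul_sqrt {Ω : Type*} [MeasurableSpace Ω] {μ : Measure Ω}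
    {p₀ a : Ω → ℝ} (hp₀ : Measurable p₀) (hp₀_nonneg : ∀ z, 0 ≤ p₀ z) (ham : Measurable a)
    (h : MemLp (fun z => a z * √(p₀ z)) 2 μ) :
    MemLp a 2 (μ.withDensity fun z => ENNReal.ofReal (p₀ z)) := by
  refine memLp_two_of_lintegral_ne_top ham.aestronglyMeasurable ?_
  have h := (lintegral_ofReal_sq h).trans_ne ENNReal.ofReal_ne_top
  rw [lintegral_withDensity_eq_lintegral_mul _ hp₀.ennreal_ofReal
    (ham.pow_const 2).ennreal_ofReal]
  convert! h using 3 with z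
  rw [Pi.mul_apply, ← ENNReal.ofReal_mul (hp₀_nonneg z), mul_pow, Real.sq_sqrt (hp₀_nonneg z),
    mul_comm]

theorem memLp_scoreFun (hq_meas : Measurable q) (hq_nonneg : ∀ y, 0 ≤ q y)
    (hz : ∀ᵐ y, √(q y) = 0 → g y = 0) (hgm : Measurable g) (hg : MemLp g 2 volume)
    (hG : Measurable G) (hum : Measurable u) (hu : MemLp u 2 ν) :
    MemLp (scoreFun q g G u) 2 (regLaw ν q G) := by
  rw [regLaw_eq_withDensity hq_meas hG]
  refine memLp_withDensity_of_mul_sqrt (measurable_regDensity hq_meas hG) (fun _ => hq_nonneg _)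
    (measurable_scoreFun hq_meas hgm hG hum) ?_
  have h := ((memLp_inner_prod hgm hg hum hu).comp_measurePreserving
    (measurePreserving_residual (ν := ν) hG)).const_mul (-2)
  refine h.ae_eq ?_
  filter_upwards [scoreFun_mul_sqrt hq_nonneg hz hG] with z hz
  rw [hz]
  rfl

theorem integral_scoreFun_mul_scoreFun (hq_meas : Measurable q) (hq_nonneg : ∀ y, 0 ≤ q y)
    (hz : ∀ᵐ y, √(q y) = 0 → g y = 0) (hgm : Measurable g) (hg : MemLp g 2 volume)
    (hG : Measurable G) (hum : Measurable u) (hu : MemLp u 2 ν)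
    {w : X → EuclideanSpace ℝ (Fin p)} (hwm : Measurable w) (hw : MemLp w 2 ν) :
    ∫ z, scoreFun q g G u z * scoreFun q g G w z ∂(regLaw ν q G) =
      ∫ x, inner ℝ (u x)
        (Matrix.toEuclideanCLM (n := Fin p) (𝕜 := ℝ) (fisherMatrix g) (w x)) ∂ν := by
  rw [regLaw_eq_withDensity hq_meas hG, integral_withDensity_ofReal
    (measurable_regDensity hq_meas hG) fun _ => hq_nonneg _]
  set F : X × EuclideanSpace ℝ (Fin p) → ℝ :=
    fun z => 4 * (inner ℝ (g z.2) (u z.1) * inner ℝ (g z.2) (w z.1)) with hF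
  have hFm : Measurable F := by
    refine (Measurable.mul ?_ ?_).const_mul 4
    · exact (hgm.comp measurable_snd).inner (hum.comp measurable_fst)
    · exact (hgm.comp measurable_snd).inner (hwm.comp measurable_fst)
  have hFi : Integrable F (ν.prod volume) :=
    ((memLp_inner_prod hgm hg hum hu).integrable_mul (memLp_inner_prod hgm hg hwm hw)).const_mul 4
  have e1 : ∫ z, regDensity q G z * (scoreFun q g G u z * scoreFun q g G w z) ∂(ν.prod volume) =
      ∫ z, F (z.1, z.2 - G z.1) ∂(ν.prod volume) := by
    refine integral_congr_ae ?_
    filter_upwards [scoreFun_mul_sqrt (u := u) hq_nonneg hz hG,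
      scoreFun_mul_sqrt (u := w) hq_nonneg hz hG] with z h1 h2
    have h3 : √(regDensity q G z) * √(regDensity q G z) = regDensity q G z :=
      Real.mul_self_sqrt (hq_nonneg _)
    calc regDensity q G z * (scoreFun q g G u z * scoreFun q g G w z)
        = (scoreFun q g G u z * √(regDensity q G z)) *
          (scoreFun q g G w z * √(regDensity q G z)) := by
            linear_combination (-scoreFun q g G u z * scoreFun q g G w z) * h3
      _ = F (z.1, z.2 - G z.1) := by rw [h1, h2]; simp only [hF]; ring
  have e2 : ∫ z, F (z.1, z.2 - G z.1) ∂(ν.prod volume) = ∫ z, F z ∂(ν.prod volume) := by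
    have hmp := measurePreserving_residual (ν := ν) hG
    conv_rhs => rw [← hmp.map_eq]
    rw [integral_map hmp.measurable.aemeasurable hFm.aestronglyMeasurable]
  rw [e1, e2, integral_prod _ hFi]
  refine integral_congr_ae (.of_forall fun x => ?_)
  simp only [hF]
  rw [inner_fisherMatrix hg, integral_const_mul]

/-- The score as a bounded operator on `L²(ν; ℝ^p)`, before composition with the linearization of
the regression map. -/
theorem exists_scoreOperator (hq_meas : Measurable q) (hq_nonneg : ∀ y, 0 ≤ q y)
    (hz : ∀ᵐ y, √(q y) = 0 → g y = 0) (hgm : Measurable g) (hg : MemLp g 2 volume)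
    (hG : Measurable G) :
    ∃ S : Lp (EuclideanSpace ℝ (Fin p)) 2 ν →L[ℝ] Lp ℝ 2 (regLaw ν q G),
      (∀ u, S u =ᵐ[regLaw ν q G] scoreFun q g G u) ∧
        ∀ u w, inner ℝ (S u) (S w) = inner ℝ u (matrixAct ν (fisherMatrix g) w) := by
  have hm : ∀ u : Lp (EuclideanSpace ℝ (Fin p)) 2 ν, MemLp (scoreFun q g G u) 2 (regLaw ν q G) :=
    fun u => memLp_scoreFun hq_meas hq_nonneg hz hgm hg hG (Lp.stronglyMeasurable u).measurable
      (Lp.memLp u)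
  have hfst : ∀ {r : X → Prop}, (∀ᵐ x ∂ν, r x) → ∀ᵐ z ∂(regLaw ν q G), r z.1 := fun h =>
    ae_regLaw_of_ae hq_meas hG (Measure.quasiMeasurePreserving_fst.ae h)
  have hinner : ∀ u w, inner ℝ ((hm u).toLp) ((hm w).toLp) =
      inner ℝ u (matrixAct ν (fisherMatrix g) w) := by
    intro u w
    rw [inner_toLp_eq_integral, L2.inner_def, integral_scoreFun_mul_scoreFun hq_meas hq_nonneg hz
      hgm hg hG (Lp.stronglyMeasurable u).measurable (Lp.memLp u)
      (Lp.stronglyMeasurable w).measurable (Lp.memLp w)]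
    refine integral_congr_ae ?_
    filter_upwards [ContinuousLinearMap.coeFn_compLpL (p := 2) (μ := ν)
      (Matrix.toEuclideanCLM (n := Fin p) (𝕜 := ℝ) (fisherMatrix g)) w] with x hx
    rw [matrixAct, hx]
  let L : Lp (EuclideanSpace ℝ (Fin p)) 2 ν →ₗ[ℝ] Lp ℝ 2 (regLaw ν q G) :=
    { toFun := fun u => (hm u).toLp
      map_add' := fun u w => by
        rw [← MemLp.toLp_add]
        refine MemLp.toLp_congr _ _ ?_
        filter_upwards [hfst (Lp.coeFn_add u w)] with z hz
        simp only [scoreFun, Pi.add_apply, Set.indicator, Set.mem_ofPred_eq]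
        rw [hz, Pi.add_apply, inner_add_right]
        split_ifs <;> ring
      map_smul' := fun c u => by
        rw [RingHom.id_apply, ← MemLp.toLp_const_smul]
        refine MemLp.toLp_congr _ _ ?_
        filter_upwards [hfst (Lp.coeFn_smul c u)] with z hz
        simp only [scoreFun, Pi.smul_apply, Set.indicator, Set.mem_ofPred_eq, smul_eq_mul]
        rw [hz, Pi.smul_apply, inner_smul_right]
        split_ifs <;> ring }
  refine ⟨L.mkContinuous √‖matrixAct ν (fisherMatrix g)‖ fun u => ?_, fun u => (hm u).coeFn_toLp,
    hinner⟩
  have h1 : ‖L u‖ ^ 2 ≤ ‖matrixAct ν (fisherMatrix g)‖ * ‖u‖ ^ 2 := by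
    rw [← real_inner_self_eq_norm_sq]
    refine (hinner u u).le.trans ((real_inner_le_norm _ _).trans ?_)
    have := (matrixAct ν (fisherMatrix g)).le_opNorm u
    nlinarith [norm_nonneg u]
  refine (Real.le_sqrt (norm_nonneg _) (by positivity)).2 h1 |>.trans (le_of_eq ?_)
  rw [Real.sqrt_mul (norm_nonneg _), Real.sqrt_sq (norm_nonneg _)]

end Model

/-! ### Quadratic mean differentiability of the regression model -/

section QuadraticMean

variable {X : Type*} [MeasurableSpace X] {p : ℕ} {ν : Measure X}
  {f : EuclideanSpace ℝ (Fin p) → ℝ} {g : EuclideanSpace ℝ (Fin p) → EuclideanSpace ℝ (Fin p)}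
  {u : X → EuclideanSpace ℝ (Fin p)}

theorem eLpNorm_inner_const_le (v : EuclideanSpace ℝ (Fin p)) :
    eLpNorm (fun y => inner ℝ (g y) v) 2 volume ≤ ‖v‖ₑ * eLpNorm g 2 volume := by
  rw [← ofReal_norm]
  refine eLpNorm_le_mul_eLpNorm_of_ae_le_mul (.of_forall fun y => ?_) 2
  rw [mul_comm]
  exact norm_inner_le_norm _ _

/-- Differentiability of `f` in `L²` along random directions `u x`, in quadratic mean over `x`. -/
theorem HasWeakGradient.tendsto_lintegral_slope_sub (h : HasWeakGradient f g) (hfm : Measurable f)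
    (hf : MemLp f 2 volume) (hgm : Measurable g) (hg : MemLp g 2 volume) (hum : Measurable u)
    (hu : MemLp u 2 ν) :
    Tendsto (fun s : ℝ => ENNReal.ofReal (1 / s ^ 2) *
      ∫⁻ x, ∫⁻ y, ENNReal.ofReal ((f (y - s • u x) - f y + s * inner ℝ (g y) (u x)) ^ 2) ∂volume ∂ν)
      (𝓝[≠] 0) (𝓝 0) := by
  let D : ℝ → X → EuclideanSpace ℝ (Fin p) → ℝ := fun s x y =>
    s⁻¹ * (f (y + s • -u x) - f y) - inner ℝ (g y) (-u x)
  have hDm : ∀ s, Measurable fun z : X × EuclideanSpace ℝ (Fin p) => D s z.1 z.2 := by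
    intro s
    have h1 : Measurable fun z : X × EuclideanSpace ℝ (Fin p) => f (z.2 + s • -u z.1) :=
      hfm.comp (measurable_snd.add ((hum.comp measurable_fst).neg.const_smul s))
    exact ((h1.sub (hfm.comp measurable_snd)).const_mul _).sub
      ((hgm.comp measurable_snd).inner (hum.comp measurable_fst).neg)
  have hbound : ∀ s ≠ 0, ∀ x,
      eLpNorm (D s x) 2 volume ≤ 2 * (‖u x‖ₑ * eLpNorm g 2 volume) := by
    intro s hs x
    have h1 := h.eLpNorm_translate_sub_le_inner hf hg (s • -u x)
    have h2 := h1.trans (eLpNorm_inner_const_le (g := g) (s • -u x))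
    have hm1 : MemLp (s⁻¹ • fun y => f (y + s • -u x) - f y) 2 volume :=
      ((memLp_translate hf _).sub hf).const_smul s⁻¹
    have e : D s x = (s⁻¹ • fun y => f (y + s • -u x) - f y) - fun y => inner ℝ (g y) (-u x) := by
      ext y; simp [D]
    rw [e, two_mul]
    refine (eLpNorm_sub_le hm1.1 (memLp_inner_const hg _).1 (by norm_num)).trans
      (add_le_add ?_ ?_)
    · rw [eLpNorm_const_smul]
      refine (mul_le_mul_right h2 _).trans (le_of_eq ?_)
      rw [enorm_smul, enorm_neg, ← mul_assoc, ← mul_assoc, ← enorm_mul, inv_mul_cancel₀ hs]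
      simp
    · exact (eLpNorm_inner_const_le _).trans (by rw [enorm_neg])
  have hlim := tendsto_lintegral_filter_of_dominated_convergence (μ := ν) (l := 𝓝[≠] (0 : ℝ))
    (F := fun s x => eLpNorm (D s x) 2 volume ^ 2) (f := fun _ => 0)
    (fun x => (2 * (‖u x‖ₑ * eLpNorm g 2 volume)) ^ 2)
    (.of_forall fun s => by
      simp only [eLpNorm_two_sq]
      exact ((hDm s).pow_const 2).ennreal_ofReal.lintegral_prod_right')
    (by
      filter_upwards [self_mem_nhdsWithin] with s hs
      exact .of_forall fun x => pow_le_pow_left₀ zero_le (hbound s hs x) 2)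
    (by
      simp only [mul_pow]
      rw [lintegral_const_mul' _ _ (by norm_num),
        lintegral_mul_const' _ _ (ENNReal.pow_ne_top hg.eLpNorm_ne_top), ← eLpNorm_two_sq_enorm]
      exact ENNReal.mul_ne_top (by norm_num) (ENNReal.mul_ne_top
        (ENNReal.pow_ne_top hu.eLpNorm_ne_top) (ENNReal.pow_ne_top hg.eLpNorm_ne_top)))
    (.of_forall fun x => by
      have := ENNReal.Tendsto.pow (n := 2) (h.tendsto_eLpNorm_slope_sub hf hg (-u x))
      rw [zero_pow two_ne_zero] at this
      exact this)
  rw [lintegral_zero] at hlim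
  refine hlim.congr' ?_
  filter_upwards [self_mem_nhdsWithin] with s hs
  have hs : s ≠ 0 := hs
  simp only [eLpNorm_two_sq]
  rw [← lintegral_const_mul' _ _ ENNReal.ofReal_ne_top]
  refine lintegral_congr fun x => ?_
  rw [← lintegral_const_mul' _ _ ENNReal.ofReal_ne_top]
  refine lintegral_congr fun y => ?_
  rw [← ENNReal.ofReal_mul (by positivity)]
  congr 1
  simp only [D, smul_neg, ← sub_eq_add_neg, inner_neg_right]
  field_simp
  ring

theorem HasWeakGradient.lintegral_translate_sub_sq_le (h : HasWeakGradient f g)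
    (hf : MemLp f 2 volume) (hg : MemLp g 2 volume) (d e : X → EuclideanSpace ℝ (Fin p)) :
    ∫⁻ x, ∫⁻ y, ENNReal.ofReal ((f (y - d x) - f (y - e x)) ^ 2) ∂volume ∂ν ≤
      eLpNorm (fun x => d x - e x) 2 ν ^ 2 * eLpNorm g 2 volume ^ 2 := by
  rw [eLpNorm_two_sq_enorm (fun x => d x - e x),
    ← lintegral_mul_const' _ _ (ENNReal.pow_ne_top hg.eLpNorm_ne_top)]
  refine lintegral_mono fun x => ?_
  rw [← eLpNorm_two_sq, ← mul_pow]
  refine pow_le_pow_left₀ zero_le ?_ 2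
  have h1 := (h.eLpNorm_translate_sub_le_inner hf hg (e x - d x)).trans
    (eLpNorm_inner_const_le (g := g) (e x - d x))
  have h2 := eLpNorm_comp_measurePreserving (p := 2) ((memLp_translate hf (e x - d x)).sub hf).1
    (measurePreserving_sub_right volume (e x))
  rw [enorm_sub_rev]
  refine le_trans (le_of_eq ?_) h1
  refine Eq.trans ?_ h2
  congr 1
  ext y
  simp

variable [IsProbabilityMeasure ν]

/-- Quadratic mean differentiability of a regression model under a merely directional linearization
of the regression map: translating by the residual reduces the claim to the error density, where the
linearization error is controlled by the Lipschitz bound in `L²` and the linear part by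
differentiability in `L²`. -/
theorem HasWeakGradient.tendsto_lintegral_regression (h : HasWeakGradient f g)
    (hfm : Measurable f) (hf : MemLp f 2 volume) (hgm : Measurable g) (hg : MemLp g 2 volume)
    (hum : Measurable u) (hu : MemLp u 2 ν) {G₀ : X → EuclideanSpace ℝ (Fin p)}
    (hG₀ : Measurable G₀) {G : ℝ → X → EuclideanSpace ℝ (Fin p)} (hG : ∀ s, Measurable (G s))
    (hlin : Tendsto (fun s : ℝ => ‖s‖ₑ⁻¹ * eLpNorm (fun x => G s x - G₀ x - s • u x) 2 ν)
      (𝓝[≠] 0) (𝓝 0)) :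
    Tendsto (fun s : ℝ => ENNReal.ofReal (1 / s ^ 2) *
      ∫⁻ z, ENNReal.ofReal ((f (z.2 - G s z.1) - f (z.2 - G₀ z.1) +
        s * inner ℝ (g (z.2 - G₀ z.1)) (u z.1)) ^ 2) ∂(ν.prod volume)) (𝓝[≠] 0) (𝓝 0) := by
  have hB := h.tendsto_lintegral_slope_sub hfm hf hgm hg hum hu
  have hA : Tendsto (fun s : ℝ => (‖s‖ₑ⁻¹ * eLpNorm (fun x => G s x - G₀ x - s • u x) 2 ν) ^ 2 *
      eLpNorm g 2 volume ^ 2) (𝓝[≠] 0) (𝓝 0) := by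
    have h1 := ENNReal.Tendsto.mul_const (b := eLpNorm g 2 volume ^ 2)
      (ENNReal.Tendsto.pow (n := 2) hlin) (.inr (ENNReal.pow_ne_top hg.eLpNorm_ne_top))
    simpa using h1
  have hAB := ENNReal.Tendsto.const_mul (a := 2) (hA.add hB) (.inr (by norm_num))
  rw [add_zero, mul_zero] at hAB
  refine tendsto_of_tendsto_of_tendsto_of_le_of_le' tendsto_const_nhds hAB
    (.of_forall fun _ => zero_le) ?_
  filter_upwards [self_mem_nhdsWithin] with s hs
  have hs : s ≠ 0 := hs
  -- the integrand in residual coordinates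
  let H : X × EuclideanSpace ℝ (Fin p) → ℝ := fun z =>
    f (z.2 - (G s z.1 - G₀ z.1)) - f z.2 + s * inner ℝ (g z.2) (u z.1)
  have hm1 : Measurable fun z : X × EuclideanSpace ℝ (Fin p) => f (z.2 - (G s z.1 - G₀ z.1)) :=
    hfm.comp (measurable_snd.sub (((hG s).sub hG₀).comp measurable_fst))
  have hm2 : Measurable fun z : X × EuclideanSpace ℝ (Fin p) => f (z.2 - s • u z.1) :=
    hfm.comp (measurable_snd.sub ((hum.comp measurable_fst).const_smul s))
  have hm3 : Measurable fun z : X × EuclideanSpace ℝ (Fin p) => s * inner ℝ (g z.2) (u z.1) :=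
    ((hgm.comp measurable_snd).inner (hum.comp measurable_fst)).const_mul s
  have hHm : Measurable H := (hm1.sub (hfm.comp measurable_snd)).add hm3
  have hAm : Measurable fun z : X × EuclideanSpace ℝ (Fin p) => ENNReal.ofReal
      ((f (z.2 - (G s z.1 - G₀ z.1)) - f (z.2 - s • u z.1)) ^ 2) :=
    ((hm1.sub hm2).pow_const 2).ennreal_ofReal
  have hBm : Measurable fun z : X × EuclideanSpace ℝ (Fin p) => ENNReal.ofReal
      ((f (z.2 - s • u z.1) - f z.2 + s * inner ℝ (g z.2) (u z.1)) ^ 2) :=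
    (((hm2.sub (hfm.comp measurable_snd)).add hm3).pow_const 2).ennreal_ofReal
  have e1 : ∫⁻ z, ENNReal.ofReal ((f (z.2 - G s z.1) - f (z.2 - G₀ z.1) +
        s * inner ℝ (g (z.2 - G₀ z.1)) (u z.1)) ^ 2) ∂(ν.prod volume) =
      ∫⁻ z, ENNReal.ofReal (H z ^ 2) ∂(ν.prod volume) := by
    rw [← (measurePreserving_residual (ν := ν) hG₀).lintegral_comp (hHm.pow_const 2).ennreal_ofReal]
    simp [H]
  have hle : ∀ z, ENNReal.ofReal (H z ^ 2) ≤
      2 * (ENNReal.ofReal ((f (z.2 - (G s z.1 - G₀ z.1)) - f (z.2 - s • u z.1)) ^ 2) +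
        ENNReal.ofReal ((f (z.2 - s • u z.1) - f z.2 + s * inner ℝ (g z.2) (u z.1)) ^ 2)) := by
    intro z
    have h2 : (2 : ℝ≥0∞) = ENNReal.ofReal 2 := (ENNReal.ofReal_ofNat 2).symm
    rw [← ENNReal.ofReal_add (sq_nonneg _) (sq_nonneg _)]
    refine le_trans ?_ (le_of_eq (congrArg (· * _) h2.symm))
    rw [← ENNReal.ofReal_mul (by norm_num)]
    refine ENNReal.ofReal_le_ofReal ?_
    have e : H z = (f (z.2 - (G s z.1 - G₀ z.1)) - f (z.2 - s • u z.1)) +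
        (f (z.2 - s • u z.1) - f z.2 + s * inner ℝ (g z.2) (u z.1)) := by
      simp only [H]; ring
    rw [e]
    exact add_sq_le
  have e2 : ∫⁻ z, ENNReal.ofReal (H z ^ 2) ∂(ν.prod volume) ≤
      2 * (∫⁻ x, ∫⁻ y, ENNReal.ofReal ((f (y - (G s x - G₀ x)) - f (y - s • u x)) ^ 2) ∂volume ∂ν +
        ∫⁻ x, ∫⁻ y, ENNReal.ofReal ((f (y - s • u x) - f y + s * inner ℝ (g y) (u x)) ^ 2) ∂volume ∂ν) := by
    refine (lintegral_mono hle).trans (le_of_eq ?_)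
    rw [lintegral_const_mul' _ _ (by norm_num), lintegral_add_left hAm,
      lintegral_prod _ hAm.aemeasurable, lintegral_prod _ hBm.aemeasurable]
  rw [e1]
  refine (mul_le_mul_right e2 _).trans ?_
  rw [mul_left_comm, mul_add]
  refine mul_le_mul_right (add_le_add ?_ le_rfl) _
  refine (mul_le_mul_right (h.lintegral_translate_sub_sq_le hf hg _ _) _).trans (le_of_eq ?_)
  rw [← mul_assoc, mul_pow]
  congr 2
  rw [one_div, ENNReal.ofReal_inv_of_pos (by positivity), ← ENNReal.inv_pow,
    Real.enorm_eq_ofReal_abs, ← ENNReal.ofReal_pow (abs_nonneg s), sq_abs]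

end QuadraticMean

/-! ### Extension to the closure and the LAN norm -/

section Operators

theorem extendToClosure_comp {V F F' : Type*} [NormedAddCommGroup V] [NormedSpace ℝ V]
    [NormedAddCommGroup F] [NormedSpace ℝ F] [CompleteSpace F] [NormedAddCommGroup F']
    [NormedSpace ℝ F'] [CompleteSpace F'] {V₀ : Submodule ℝ V} (S : F →L[ℝ] F')
    (T : V₀ →L[ℝ] F) : extendToClosure (S ∘L T) = S ∘L extendToClosure T := by
  have hiso : Isometry (toClosure V₀) := fun _ _ => rfl
  refine ContinuousLinearMap.extend_unique _ ?_ hiso.isUniformInducing _ ?_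
  · exact (denseRange_inclusion_iff (t := (V₀.topologicalClosure : Set V))
      V₀.le_topologicalClosure).2 fun _ hx => hx
  · ext h
    simp only [ContinuousLinearMap.comp_apply, extendToClosure_apply]

variable {p : ℕ}

open scoped MatrixOrder in
theorem inner_matrixSqrt {M : Matrix (Fin p) (Fin p) ℝ} (hM : M.PosSemidef)
    (x : EuclideanSpace ℝ (Fin p)) :
    inner ℝ (Matrix.toEuclideanCLM (n := Fin p) (𝕜 := ℝ) (matrixSqrt M) x)
      (Matrix.toEuclideanCLM (n := Fin p) (𝕜 := ℝ) (matrixSqrt M) x) =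
      inner ℝ x (Matrix.toEuclideanCLM (n := Fin p) (𝕜 := ℝ) M x) := by
  have hsq : matrixSqrt M * matrixSqrt M = M :=
    CFC.sqrt_mul_sqrt_self M (Matrix.nonneg_iff_posSemidef.2 hM)
  have hsa : star (matrixSqrt M) = matrixSqrt M :=
    (IsSelfAdjoint.of_nonneg (CFC.sqrt_nonneg M)).star_eq
  have hadj : ContinuousLinearMap.adjoint
      (Matrix.toEuclideanCLM (n := Fin p) (𝕜 := ℝ) (matrixSqrt M)) =
      Matrix.toEuclideanCLM (n := Fin p) (𝕜 := ℝ) (matrixSqrt M) := by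
    rw [← ContinuousLinearMap.star_eq_adjoint, ← map_star, hsa]
  conv_rhs => rw [← hsq, map_mul]
  rw [← ContinuousLinearMap.adjoint_inner_right, hadj]
  rfl

theorem lanNorm_sq {X V : Type*} [MeasurableSpace X] [NormedAddCommGroup V] [NormedSpace ℝ V]
    {ν : Measure X} {V₀ : Submodule ℝ V} {M : Matrix (Fin p) (Fin p) ℝ} (hM : M.PosSemidef)
    (I : V₀ →L[ℝ] Lp (EuclideanSpace ℝ (Fin p)) 2 ν) (h : V₀) :
    lanNorm M I h ^ 2 = inner ℝ (I h) (matrixAct ν M (I h)) := by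
  rw [lanNorm, ← real_inner_self_eq_norm_sq, L2.inner_def, L2.inner_def]
  refine integral_congr_ae ?_
  filter_upwards [ContinuousLinearMap.coeFn_compLpL (p := 2) (μ := ν)
      (Matrix.toEuclideanCLM (n := Fin p) (𝕜 := ℝ) M) (I h),
    ContinuousLinearMap.coeFn_compLpL (p := 2) (μ := ν)
      (Matrix.toEuclideanCLM (n := Fin p) (𝕜 := ℝ) (matrixSqrt M)) (I h)] with x h1 h2
  rw [matrixAct, matrixAct, h1, h2, inner_matrixSqrt hM]

end Operators

/-! ### The regression model as a locally asymptotically normal model -/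

section Final

theorem scoreFun_eq_mul_inner {X : Type*} {p : ℕ} {q : EuclideanSpace ℝ (Fin p) → ℝ}
    {g : EuclideanSpace ℝ (Fin p) → EuclideanSpace ℝ (Fin p)} (hq_nonneg : ∀ y, 0 ≤ q y)
    (G u : X → EuclideanSpace ℝ (Fin p))
    (z : X × EuclideanSpace ℝ (Fin p)) :
    scoreFun q g G u z = -2 * inner ℝ (u z.1) ((√(q (z.2 - G z.1)))⁻¹ • g (z.2 - G z.1)) := by
  unfold scoreFun
  rw [inner_smul_right, real_inner_comm]
  rcases eq_or_lt_of_le (hq_nonneg (z.2 - G z.1)) with h0 | h0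
  · rw [Set.indicator_of_notMem (by simp [regDensity, ← h0]), ← h0]
    simp
  · rw [Set.indicator_of_mem (by simpa [regDensity] using h0)]
    simp only [regDensity]
    ring

variable {X V : Type*} [MeasurableSpace X] [NormedAddCommGroup V] [InnerProductSpace ℝ V]
  {p : ℕ} {ν : Measure X} [IsProbabilityMeasure ν] {q : EuclideanSpace ℝ (Fin p) → ℝ}
  {g : EuclideanSpace ℝ (Fin p) → EuclideanSpace ℝ (Fin p)}

theorem scoreFun_congr (hq_meas : Measurable q)
    {g' : EuclideanSpace ℝ (Fin p) → EuclideanSpace ℝ (Fin p)} (h : g' =ᵐ[volume] g)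
    {G : X → EuclideanSpace ℝ (Fin p)} (hG : Measurable G) (u : X → EuclideanSpace ℝ (Fin p)) :
    scoreFun q g' G u =ᵐ[regLaw ν q G] scoreFun q g G u := by
  filter_upwards [ae_regLaw_of_ae hq_meas hG (ae_residual (ν := ν) hG h)] with z hz
  simp only [scoreFun, Set.indicator]
  rw [hz]

theorem isQMD_regression (hq_meas : Measurable q) (hq_nonneg : ∀ y, 0 ≤ q y)
    (hf : MemLp (fun y => √(q y)) 2 volume) (hgm : Measurable g) (hg : MemLp g 2 volume)
    (h : HasWeakGradient (fun y => √(q y)) g) {Θ : Set V}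
    {G : V → Lp (EuclideanSpace ℝ (Fin p)) 2 ν} {θ₀ : V} {V₀ : Submodule ℝ V}
    {I : V₀ →L[ℝ] Lp (EuclideanSpace ℝ (Fin p)) 2 ν} (hI : IsLinearization Θ G θ₀ V₀ I)
    {A : V₀ → X × EuclideanSpace ℝ (Fin p) → ℝ}
    (hA : ∀ k, A k =ᵐ[regLaw ν q (G θ₀)] scoreFun q g (G θ₀) (I k)) :
    IsQMD (ν.prod volume) (fun θ => regDensity q (G θ)) θ₀ V₀ A := by
  intro k
  have hz := h.ae_eq_zero_of_eq_zero hf hg fun y => Real.sqrt_nonneg _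
  have hGm : ∀ θ, Measurable (G θ) := fun θ => (Lp.stronglyMeasurable (G θ)).measurable
  have hlin : Tendsto (fun s : ℝ => ‖s‖ₑ⁻¹ *
      eLpNorm (fun x => G (θ₀ + s • (k : V)) x - G θ₀ x - s • I k x) 2 ν) (𝓝[≠] 0) (𝓝 0) := by
    have h1 := (hI.isLittleO k).norm_norm.tendsto_div_nhds_zero.mono_left
      (nhdsWithin_le_nhds (s := {0}ᶜ))
    have h2 := ENNReal.tendsto_ofReal h1
    rw [ENNReal.ofReal_zero] at h2
    refine h2.congr' ?_
    filter_upwards [self_mem_nhdsWithin] with s hs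
    have hs : s ≠ 0 := hs
    rw [ENNReal.ofReal_div_of_pos (norm_pos_iff.2 hs), ofReal_norm, ofReal_norm, Lp.enorm_def,
      mul_comm, ENNReal.div_eq_inv_mul, mul_comm]
    congr 1
    refine eLpNorm_congr_ae ?_
    rw [map_smul]
    filter_upwards [Lp.coeFn_sub (G (θ₀ + s • (k : V)) - G θ₀) (s • I k),
      Lp.coeFn_sub (G (θ₀ + s • (k : V))) (G θ₀), Lp.coeFn_smul s (I k)] with x h1 h2 h3
    rw [h1, Pi.sub_apply, h2, h3]
    rfl
  refine (h.tendsto_lintegral_regression hq_meas.sqrt hf hgm hg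
    (Lp.stronglyMeasurable (I k)).measurable (Lp.memLp (I k)) (hGm θ₀)
    (fun s => hGm (θ₀ + s • (k : V))) hlin).congr fun s => ?_
  congr 1
  refine lintegral_congr_ae ?_
  have hA' := hA k
  rw [regLaw_eq_withDensity hq_meas (hGm θ₀)] at hA'
  have hA'' := (ae_withDensity_iff (measurable_regDensity hq_meas (hGm θ₀)).ennreal_ofReal).1 hA'
  filter_upwards [hA'', scoreFun_mul_sqrt (u := I k) hq_nonneg hz (hGm θ₀)] with z h1 h2
  have h3 : A k z * √(regDensity q (G θ₀) z) =
      -2 * inner ℝ (g (z.2 - G θ₀ z.1)) (I k z.1) := by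
    rw [← h2]
    rcases eq_or_lt_of_le (hq_nonneg (z.2 - G θ₀ z.1)) with h0 | h0
    · have : regDensity q (G θ₀) z = 0 := h0.symm
      simp [this]
    · rw [h1 (ENNReal.ofReal_pos.2 h0).ne']
  rw [mul_assoc, h3]
  simp only [regDensity]
  congr 2
  ring

theorem isLAN_regression (hq_meas : Measurable q) (hq_nonneg : ∀ y, 0 ≤ q y)
    (hq_int : ∫⁻ y, ENNReal.ofReal (q y) = 1) {G : V → Lp (EuclideanSpace ℝ (Fin p)) 2 ν}
    {θ₀ : V} {V₀ : Submodule ℝ V} {I : V₀ →L[ℝ] Lp (EuclideanSpace ℝ (Fin p)) 2 ν}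
    (hM : (fisherMatrix g).PosSemidef) {A : V₀ → Lp ℝ 2 (regLaw ν q (G θ₀))}
    (hA : ∀ h, A h =ᵐ[regLaw ν q (G θ₀)] scoreFun q g (G θ₀) (I h))
    (hnorm : ∀ h, inner ℝ (A h) (A h) = inner ℝ (I h) (matrixAct ν (fisherMatrix g) (I h)))
    (hqmd : IsQMD (ν.prod volume) (fun θ => regDensity q (G θ)) θ₀ V₀ (fun h => A h)) :
    IsLAN (fun θ => regLaw ν q (G θ)) θ₀ V₀
      (fun N h ω => -(2 / √(N : ℝ)) * ∑ i : Fin N,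
        inner ℝ (I h (ω i).1)
          ((√(q ((ω i).2 - G θ₀ (ω i).1)))⁻¹ • g ((ω i).2 - G θ₀ (ω i).1)))
      (lanNorm (fisherMatrix g) I) := by
  intro h θ
  have hGm : ∀ θ, Measurable (G θ) := fun θ => (Lp.stronglyMeasurable (G θ)).measurable
  have hs : Tendsto (fun N : ℕ => 1 / √(N : ℝ)) atTop (𝓝[≠] 0) := by
    refine tendsto_nhdsWithin_iff.2 ⟨?_, ?_⟩
    · simp only [one_div]
      exact tendsto_inv_atTop_zero.comp (Real.tendsto_sqrt_atTop.comp tendsto_natCast_atTop_atTop)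
    · filter_upwards [eventually_gt_atTop 0] with N hN
      have hN' : 0 < √(N : ℝ) := Real.sqrt_pos.2 (by exact_mod_cast hN)
      exact (one_div_pos.2 hN').ne'
  have hq : Tendsto (fun N : ℕ => (N : ℝ≥0∞) * ∫⁻ z, ENNReal.ofReal
      ((√(regDensity q (G (θ N)) z) - √(regDensity q (G θ₀) z) -
        1 / √N / 2 * A h z * √(regDensity q (G θ₀) z)) ^ 2) ∂(ν.prod volume)) atTop (𝓝 0) := by
    refine ((hqmd h).comp hs).congr' ?_
    filter_upwards [eventually_gt_atTop 0] with N hN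
    have hN' : (0 : ℝ) < N := by exact_mod_cast hN
    simp only [Function.comp_apply, θ]
    congr 1
    rw [div_pow, one_pow, one_div_one_div, Real.sq_sqrt hN'.le, ENNReal.ofReal_natCast]
  have key := lan_of_qmd (μ := ν.prod volume) (p₀ := regDensity q (G θ₀))
    (p₁ := fun N => regDensity q (G (θ N))) (a := A h) (P := regLaw ν q (G θ₀))
    (Q := fun N => regLaw ν q (G (θ N)))
    (measurable_regDensity hq_meas (hGm _)) (fun _ => hq_nonneg _)
    (lintegral_regDensity hq_meas hq_int (hGm _)) (fun N => measurable_regDensity hq_meas (hGm _))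
    (fun _ _ => hq_nonneg _) (fun N => lintegral_regDensity hq_meas hq_int (hGm _))
    (regLaw_eq_withDensity hq_meas (hGm _)) (fun N => regLaw_eq_withDensity hq_meas (hGm _))
    (Lp.stronglyMeasurable (A h)).measurable (Lp.memLp (A h)) hq
  have hσ : ∫ z, A h z ^ 2 ∂(regLaw ν q (G θ₀)) = lanNorm (fisherMatrix g) I h ^ 2 := by
    rw [lanNorm_sq hM, ← hnorm, L2.inner_def]
    refine integral_congr_ae (.of_forall fun z => ?_)
    simp [sq]
  rw [hσ] at key
  refine ⟨key.1, fun δ hδ => (key.2.1 δ hδ).congr fun N => measure_congr ?_, key.2.2⟩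
  have hP : IsProbabilityMeasure (regLaw ν q (G θ₀)) := ⟨by
    rw [regLaw_eq_withDensity hq_meas (hGm _), withDensity_apply _ .univ]
    simpa using lintegral_regDensity hq_meas hq_int (hGm θ₀)⟩
  have hall : ∀ᵐ ω ∂(sampleLaw (regLaw ν q (G θ₀)) N), ∀ i,
      A h (ω i) = scoreFun q g (G θ₀) (I h) (ω i) :=
    ae_all_iff.2 fun i => (measurePreserving_eval (fun _ : Fin N => regLaw ν q (G θ₀))
      i).quasiMeasurePreserving.ae (hA h)
  filter_upwards [hall] with ω hω
  have e : (√(N : ℝ))⁻¹ * ∑ i, A h (ω i) = -(2 / √(N : ℝ)) * ∑ i : Fin N,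
      inner ℝ (I h (ω i).1)
        ((√(q ((ω i).2 - G θ₀ (ω i).1)))⁻¹ • g ((ω i).2 - G θ₀ (ω i).1)) := by
    simp only [hω, scoreFun_eq_mul_inner hq_nonneg, ← Finset.mul_sum]
    ring
  refine propext ?_
  change δ ≤ _ ↔ δ ≤ _
  rw [e]

end Final

end RegressionLAN

theorem mainTheorem3 {X V : Type*} [MeasurableSpace X] [NormedAddCommGroup V]
    [InnerProductSpace ℝ V] [CompleteSpace V]
    (p : ℕ) (hp : 1 ≤ p) (ν : Measure X) [IsProbabilityMeasure ν]
    (q : EuclideanSpace ℝ (Fin p) → ℝ) (hq_meas : Measurable q) (hq_nonneg : ∀ y, 0 ≤ q y)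
    (hq_int : ∫⁻ y, ENNReal.ofReal (q y) = 1) (hq_H1 : MemH1 fun y => √(q y))
    (g : EuclideanSpace ℝ (Fin p) → EuclideanSpace ℝ (Fin p))
    (hg : HasWeakGradient (fun y => √(q y)) g)
    (Θ : Set V) (G : V → Lp (EuclideanSpace ℝ (Fin p)) 2 ν) (θ₀ : V) (V₀ : Submodule ℝ V)
    (I : V₀ →L[ℝ] Lp (EuclideanSpace ℝ (Fin p)) 2 ν) (hI : IsLinearization Θ G θ₀ V₀ I) :
    (∀ θ ∈ Θ, regLaw ν q (G θ) =
      (ν.prod volume).withDensity fun z => ENNReal.ofReal (regDensity q (G θ) z)) ∧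
    (∃ A : V₀ →L[ℝ] Lp ℝ 2 (regLaw ν q (G θ₀)),
      (∀ h : V₀, A h =ᵐ[regLaw ν q (G θ₀)] scoreFun q g (G θ₀) (I h)) ∧
      IsQMD (ν.prod volume) (fun θ => regDensity q (G θ)) θ₀ V₀ (fun h => A h) ∧
      (extendToClosure A).adjoint ∘L extendToClosure A =
        (extendToClosure I).adjoint ∘L matrixAct ν (fisherMatrix g) ∘L extendToClosure I) ∧
    (∀ i j : Fin p, Integrable (fun y => g y i * g y j) volume ∧
      Integrable (fun y => g y i / √(q y) * (g y j / √(q y))) (errorLaw q) ∧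
      fisherMatrix g i j = 4 * ∫ y, g y i / √(q y) * (g y j / √(q y)) ∂(errorLaw q)) ∧
    (fisherMatrix g).PosDef ∧
    IsLAN (fun θ => regLaw ν q (G θ)) θ₀ V₀
      (fun N h ω => -(2 / √(N : ℝ)) * ∑ i : Fin N,
        inner ℝ (I h (ω i).1)
          ((√(q ((ω i).2 - G θ₀ (ω i).1)))⁻¹ • g ((ω i).2 - G θ₀ (ω i).1)))
      (lanNorm (fisherMatrix g) I) := by
  obtain ⟨hf, g₁, hg₁, hg₁w⟩ := hq_H1
  have hgL : MemLp g 2 volume := hg₁.ae_eq (hg₁w.ae_eq hg)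
  -- `g` is only almost everywhere measurable; the Fubini arguments need a Borel version of it
  obtain ⟨g', hg'm, hgg'⟩ : ∃ g', Measurable g' ∧ g =ᵐ[volume] g' :=
    ⟨hgL.1.mk g, hgL.1.stronglyMeasurable_mk.measurable, hgL.1.ae_eq_mk⟩
  have hg'L : MemLp g' 2 volume := hgL.ae_eq hgg'
  have hg'w := hg.congr hgg'
  have hz' := hg'w.ae_eq_zero_of_eq_zero hf hg'L fun y => Real.sqrt_nonneg _
  have hGm : ∀ θ, Measurable (G θ) := fun θ => (Lp.stronglyMeasurable (G θ)).measurable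
  have hPD := posDef_fisherMatrix hq_meas hq_nonneg hq_int hf hgL hg
  obtain ⟨S, hS, hSinner⟩ := exists_scoreOperator (ν := ν) hq_meas hq_nonneg hz' hg'm hg'L (hGm θ₀)
  rw [← fisherMatrix_congr hgg'] at hSinner
  have hA : ∀ h, (S ∘L I) h =ᵐ[regLaw ν q (G θ₀)] scoreFun q g (G θ₀) (I h) := fun h =>
    (hS (I h)).trans (scoreFun_congr hq_meas hgg'.symm (hGm θ₀) _)
  have hqmd : IsQMD (ν.prod volume) (fun θ => regDensity q (G θ)) θ₀ V₀ (fun h => (S ∘L I) h) :=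
    isQMD_regression hq_meas hq_nonneg hf hg'm hg'L hg'w hI fun h => hS (I h)
  refine ⟨fun θ _ => regLaw_eq_withDensity hq_meas (hGm θ), ⟨S ∘L I, hA, hqmd, ?_⟩, fun i j =>
    ⟨integrable_coord_mul_coord hgL i j, fisherMatrix_errorLaw hq_meas hq_nonneg hgL
      (hg.ae_eq_zero_of_eq_zero hf hgL fun y => Real.sqrt_nonneg _) i j⟩, hPD,
    isLAN_regression hq_meas hq_nonneg hq_int hPD.posSemidef hA (fun h => hSinner _ _) hqmd⟩
  have hSS : S.adjoint ∘L S = matrixAct ν (fisherMatrix g) := by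
    ext1 w
    refine ext_inner_left ℝ fun u => ?_
    rw [ContinuousLinearMap.comp_apply, ContinuousLinearMap.adjoint_inner_right, hSinner]
  rw [extendToClosure_comp, ContinuousLinearMap.adjoint_comp, ← hSS]
  rfl
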